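/- Let $K$ be a field of characteristic $0$ with a derivation $\partial$. Let $G$ be a linear differential algebraic group over $K$ with coordinate ring $A=K\{G\}$, that is, let $A$ be a commutative Hopf algebra over $K$ with a derivation $\partial$ extending that of $K$, such that the comultiplication $\Delta$, the counit $\varepsilon$ and the antipode $S$ commute with $\partial$ (on $A\otimes_K A$ one has $\partial(a\otimes b)=\partial a\otimes b+a\otimes\partial b$), and such that $A$ is finitely $\partial$-generated: there is a finite $X\subset A$ for which $A$ is generated as a $K$-algebra by the $\partial^i x$, $x\in X$, $i\ge 0$. A differential representation of $G$ is a finite-dimensional $K$-vector space $V$ with a $K$-linear coaction $\rho_V:V\to V\otimes_K A$ such that $(\mathrm{id}\otimes\Delta)\rho_V=(\rho_V\otimes\mathrm{id})\rho_V$ and $(\mathrm{id}\otimes\varepsilon)\rho_V=\mathrm{id}$; a $G$-morphism is a $K$-linear map commuting with the coactions. Let $V\otimes W$ be the tensor product representation, and let $V^{(1)}=K[\partial]_{\le 1}\otimes_K V$, where $K[\partial]$ is the ring of linear differential operators ($\partial c=c\,\partial+\partial(c)$ for $c\in K$), with the coaction $\rho(1\otimes v)=\rho_V(v)$ and $\rho(\partial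 v)=\sum_i(\partial v_i\otimes a_i+v_i\otimes\partial a_i)$ if $\rho_V(v)=\sum_i v_i\otimes a_i$; here $v=1\otimes v$ and $\partial v=\partial\otimes v$. For $u\in V^*$ let $F(u)\in (V^{(1)})^*$ be given by $F(u)(v)=u(v)$, $F(u)(\partial v)=\partial(u(v))$. Let $\psi_V:V\otimes V^*\to A$, $\psi_V(v\otimes u)=(u\otimes\mathrm{id})(\rho_V(v))$, be the map of matrix coefficients; as a function on $G$, $\psi_V(v\otimes u)(g)=u(g\cdot v)$. Let $\mathcal A$ be the quotient of $\bigoplus_V V\otimes V^*$, the sum over all differential representations of $G$, by the subspace spanned by the elements $i_V\big((\mathrm{id}\otimes\phi^*)(z)\big)-i_W\big((\phi\otimes\mathrm{id})(z)\big)$ for all $G$-morphisms $\phi:V\to W$ and $z\in V\otimes W^*$, where $i_V$ is the inclusion of the summand $V\otimes V^*$, and let $a_V(v\otimes u)\in\mathcal A$ be the class of $i_V(v\otimes u)$. With the product $a_V(v\otimes u)\,a_W(w\otimes t)=a_{V\otimes W}((v\otimes w)\otimes(u\otimes t))$ and the derivation $\partial(a_V(v\otimes u))=a_{V^{(1)}}(\partial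 v\otimes F(u))$, $\mathcal A$ is a commutative $\partial$-$K$-algebra, whose unit comes from the trivial representation. Then: 1. $\mathcal A$ is a finitely $\partial$-generated $\partial$-$K$-algebra; 2. there is a surjective homomorphism of $\partial$-$K$-algebras $\Phi:\mathcal A\to A$ such that $\Phi\circ a_V=\psi_V$ for all differential representations $V$ of $G$; 3. $\Phi$ is an isomorphism of $\partial$-$K$-algebras. -/

import Mathlib

open scoped TensorProduct Differential

universe u

noncomputable section

namespace DiffTannaka

section Prolongation

variable {K : Type*} [Field K] [Differential K]

/-- A pair consisting of a `K`-linear map `lin : M → N` and an additive map `der : M → N` such that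
`der (c • m) = c • der m + c′ • lin m`. -/
structure LeibnizPair (K : Type*) [Field K] [Differential K] (M N : Type*)
    [AddCommGroup M] [Module K M] [AddCommGroup N] [Module K N] where
  lin : M →ₗ[K] N
  der : M →+ N
  leibniz : ∀ (c : K) (m : M), der (c • m) = c • der m + c′ • lin m

variable {M N P M' N' : Type*} [AddCommGroup M] [Module K M] [AddCommGroup N] [Module K N]
  [AddCommGroup P] [Module K P] [AddCommGroup M'] [Module K M'] [AddCommGroup N'] [Module K N']

/-- Precomposition of a Leibniz pair with a `K`-linear map. -/
def LeibnizPair.comp (d : LeibnizPair K N P) (f : M →ₗ[K] N) : LeibnizPair K M P where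
  lin := d.lin ∘ₗ f
  der := d.der.comp f.toAddMonoidHom
  leibniz c m := by simp [d.leibniz]

/-- The tensor product of two Leibniz pairs:
`m ⊗ m' ↦ der m ⊗ lin m' + lin m ⊗ der m'`, over `lin ⊗ lin`. -/
def LeibnizPair.tensor (d : LeibnizPair K M N) (e : LeibnizPair K M' N') :
    LeibnizPair K (M ⊗[K] M') (N ⊗[K] N') where
  lin := TensorProduct.map d.lin e.lin
  der := TensorProduct.liftAddHom
    (AddMonoidHom.mk' (fun m => AddMonoidHom.mk'
        (fun m' => d.der m ⊗ₜ[K] e.lin m' + d.lin m ⊗ₜ[K] e.der m')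
        (fun x y => by simp only [map_add, TensorProduct.tmul_add]; abel))
      (fun x y => by
        ext m'
        simp only [map_add, TensorProduct.add_tmul, AddMonoidHom.mk'_apply,
          AddMonoidHom.add_apply]
        abel))
    (fun c m m' => by
      simp only [AddMonoidHom.mk'_apply, d.leibniz, e.leibniz, map_smul, TensorProduct.add_tmul,
        TensorProduct.tmul_add, TensorProduct.smul_tmul', TensorProduct.tmul_smul]
      abel)
  leibniz c x := by
    induction x with
    | zero => simp
    | add x y hx hy => simp only [smul_add, map_add, hx, hy]; abel
    | tmul m m' =>
      simp only [TensorProduct.smul_tmul', TensorProduct.liftAddHom_tmul, AddMonoidHom.mk'_apply,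
        d.leibniz, map_smul, TensorProduct.add_tmul, TensorProduct.map_tmul, smul_add]
      abel

@[simp] lemma LeibnizPair.tensor_der_tmul (d : LeibnizPair K M N) (e : LeibnizPair K M' N')
    (m : M) (m' : M') :
    (d.tensor e).der (m ⊗ₜ m') = d.der m ⊗ₜ[K] e.lin m' + d.lin m ⊗ₜ[K] e.der m' := rfl

@[simp] lemma LeibnizPair.tensor_lin (d : LeibnizPair K M N) (e : LeibnizPair K M' N') :
    (d.tensor e).lin = TensorProduct.map d.lin e.lin := rfl

/-- The derivation of a differential `K`-algebra, over the identity. -/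
def derPair (K : Type*) [Field K] [Differential K] (R : Type*) [CommRing R] [Algebra K R]
    [Differential R] [DifferentialAlgebra K R] : LeibnizPair K R R where
  lin := LinearMap.id
  der := (Differential.deriv (R := R)).toLinearMap.toAddMonoidHom
  leibniz c x := by
    simp [Algebra.smul_def, deriv_algebraMap]
    ring

@[simp] lemma derPair_der (R : Type*) [CommRing R] [Algebra K R]
    [Differential R] [DifferentialAlgebra K R] (x : R) : (derPair K R).der x = x′ := rfl

@[simp] lemma derPair_lin (R : Type*) [CommRing R] [Algebra K R]
    [Differential R] [DifferentialAlgebra K R] : (derPair K R).lin = LinearMap.id := rfl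

/-- The first prolongation `V⁽¹⁾ = K[∂]_{≤ 1} ⊗_K V`, in which `K[∂]_{≤ 1}` is tensored as a right
`K`-module and which is a `K`-space through the left multiplication of `K[∂]`.
The pair `(v₀, v₁)` stands for `1 ⊗ v₀ + ∂ ⊗ v₁`. Because of `∂ ⊗ (c • v) = (∂ c) ⊗ v =
c • (∂ ⊗ v) + c′ • (1 ⊗ v)`, the scalar multiplication is
`c • (v₀, v₁) = (c • v₀ - c′ • v₁, c • v₁)`. -/
def Prolong (V : Type*) : Type _ := V × V

instance (V : Type*) [AddCommGroup V] : AddCommGroup (Prolong V) :=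
  inferInstanceAs (AddCommGroup (V × V))

namespace Prolong

variable {V : Type*} [AddCommGroup V] [Module K V]

instance : SMul K (Prolong V) where
  smul c x := ((c • x.1 - c′ • x.2, c • x.2) : V × V)

lemma smul_def (c : K) (x : Prolong V) :
    c • x = ((c • x.1 - c′ • x.2, c • x.2) : V × V) := rfl

lemma fst_add (x y : Prolong V) : (x + y).1 = x.1 + y.1 := rfl
lemma snd_add (x y : Prolong V) : (x + y).2 = x.2 + y.2 := rfl
lemma fst_smul (c : K) (x : Prolong V) : (c • x).1 = c • x.1 - c′ • x.2 := rfl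
lemma snd_smul (c : K) (x : Prolong V) : (c • x).2 = c • x.2 := rfl

instance : Module K (Prolong V) where
  one_smul x := Prod.ext (by simp [fst_smul]) (by simp [snd_smul])
  mul_smul a b x := Prod.ext
    (by
      simp only [fst_smul, snd_smul, Derivation.leibniz, smul_eq_mul, add_smul, mul_smul, smul_sub]
      rw [smul_comm b a′ x.2]; abel)
    (by simp [snd_smul, mul_smul])
  smul_zero a := Prod.ext
    (by change a • (0 : V) - a′ • (0 : V) = 0; simp) (by change a • (0 : V) = 0; simp)
  smul_add a x y := Prod.ext
    (by simp only [fst_smul, fst_add, snd_add, smul_add]; abel)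
    (by simp [snd_smul, snd_add])
  add_smul a b x := Prod.ext
    (by simp only [fst_smul, fst_add, map_add, add_smul]; abel)
    (by simp [snd_smul, snd_add, add_smul])
  zero_smul x := Prod.ext
    (by change (0 : K) • x.1 - (0 : K)′ • x.2 = 0; simp) (by change (0 : K) • x.2 = 0; simp)

variable (K V)

/-- The inclusion `V → V⁽¹⁾`, `v ↦ 1 ⊗ v`. -/
def incl : V →ₗ[K] Prolong V where
  toFun v := ((v, 0) : V × V)
  map_add' x y := Prod.ext rfl (by change (0 : V) = 0 + 0; simp)
  map_smul' c x := Prod.ext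
    (by change c • x = c • x - c′ • (0 : V); simp) (by change (0 : V) = c • (0 : V); simp)

/-- The map `∂ : V → V⁽¹⁾`, `v ↦ ∂ ⊗ v`. -/
def der (V : Type*) [AddCommGroup V] : V →+ Prolong V :=
  AddMonoidHom.mk' (fun v => ((0, v) : V × V))
    (fun x y => Prod.ext (by change (0 : V) = 0 + 0; simp) rfl)

/-- The projection `V⁽¹⁾ → V`, `1 ⊗ v ↦ 0`, `∂ ⊗ v ↦ v`. -/
def proj : Prolong V →ₗ[K] V where
  toFun x := x.2
  map_add' _ _ := rfl
  map_smul' _ _ := rfl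

variable {V}

lemma der_smul (c : K) (v : V) : der V (c • v) = c • der V v + c′ • incl K V v :=
  Prod.ext (by change (0 : V) = (c • (0 : V) - c′ • v) + (c′ • v - c′′ • (0 : V)); simp)
    (by change c • v = c • v + c′ • (0 : V); simp)

lemma eq_incl_add_der (x : Prolong V) : x = incl K V x.1 + der V x.2 :=
  Prod.ext (by change x.1 = x.1 + 0; simp) (by change x.2 = 0 + x.2; simp)

@[simp] lemma proj_incl (v : V) : proj K V (incl K V v) = 0 := rfl
@[simp] lemma proj_der (v : V) : proj K V (der V v) = v := rfl

instance [FiniteDimensional K V] : FiniteDimensional K (Prolong V) := by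
  refine Module.finite_def.2
    (Submodule.fg_of_fg_map_of_fg_inf_ker (proj K V) (IsNoetherian.noetherian _) ?_)
  have h : (⊤ ⊓ LinearMap.ker (proj K V) : Submodule K (Prolong V))
      = LinearMap.range (incl K V) := by
    ext x
    constructor
    · rintro ⟨-, hx⟩
      exact ⟨x.1, Prod.ext rfl (Eq.symm hx)⟩
    · rintro ⟨v, rfl⟩
      exact ⟨trivial, rfl⟩
  rw [h, LinearMap.range_eq_map]
  exact Submodule.FG.map _ (Module.finite_def.1 inferInstance)

variable (V)

/-- The pair `(v ↦ 1 ⊗ v, v ↦ ∂ ⊗ v)`. -/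
def pair : LeibnizPair K V (Prolong V) where
  lin := incl K V
  der := der V
  leibniz := der_smul K

@[simp] lemma pair_lin : (pair K V).lin = incl K V := rfl
@[simp] lemma pair_der : (pair K V).der = der V := rfl

variable {V} {K}

/-- The linear map `V⁽¹⁾ → N` with `1 ⊗ v ↦ lin v` and `∂ ⊗ v ↦ der v`. -/
def lift (d : LeibnizPair K V N) : Prolong V →ₗ[K] N where
  toFun x := d.lin x.1 + d.der x.2
  map_add' x y := by simp only [fst_add, snd_add, map_add]; abel
  map_smul' c x := by
    simp only [fst_smul, snd_smul, map_sub, map_smul, d.leibniz, RingHom.id_apply, smul_add]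
    abel

@[simp] lemma lift_incl (d : LeibnizPair K V N) (v : V) : lift d (incl K V v) = d.lin v := by
  change d.lin v + d.der 0 = _; simp

@[simp] lemma lift_der (d : LeibnizPair K V N) (v : V) : lift d (der V v) = d.der v := by
  change d.lin 0 + d.der v = _; simp

lemma hom_ext {f g : Prolong V →ₗ[K] N} (h₀ : ∀ v, f (incl K V v) = g (incl K V v))
    (h₁ : ∀ v, f (der V v) = g (der V v)) : f = g := by
  ext x
  rw [eq_incl_add_der K x, map_add, map_add, h₀, h₁]

/-- The prolongation `φ⁽¹⁾ : V⁽¹⁾ → W⁽¹⁾` of a linear map, `1 ⊗ v ↦ 1 ⊗ φ v`,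
`∂ ⊗ v ↦ ∂ ⊗ φ v`. -/
def map {W : Type*} [AddCommGroup W] [Module K W] (φ : V →ₗ[K] W) :
    Prolong V →ₗ[K] Prolong W :=
  lift ((pair K W).comp φ)

@[simp] lemma map_incl {W : Type*} [AddCommGroup W] [Module K W] (φ : V →ₗ[K] W) (v : V) :
    map φ (incl K V v) = incl K W (φ v) := by simp [map, LeibnizPair.comp]

@[simp] lemma map_der {W : Type*} [AddCommGroup W] [Module K W] (φ : V →ₗ[K] W) (v : V) :
    map φ (der V v) = der W (φ v) := by simp [map, LeibnizPair.comp]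

/-- The map `F : V* → (V⁽¹⁾)*`, `F(u)(1 ⊗ v) = u(v)`, `F(u)(∂ ⊗ v) = ∂(u(v))`. -/
def dualF (u : Module.Dual K V) : Module.Dual K (Prolong V) :=
  lift ((derPair K K).comp u)

@[simp] lemma dualF_incl (u : Module.Dual K V) (v : V) : dualF u (incl K V v) = u v := by
  simp [dualF, LeibnizPair.comp]

@[simp] lemma dualF_der (u : Module.Dual K V) (v : V) : dualF u (der V v) = (u v)′ := by
  simp [dualF, LeibnizPair.comp]

lemma dualF_add (u t : Module.Dual K V) : dualF (u + t) = dualF u + dualF t :=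
  hom_ext (by simp) (by simp)

lemma dualF_smul (c : K) (u : Module.Dual K V) :
    dualF (c • u) = c • dualF u + c′ • (u ∘ₗ proj K V) :=
  hom_ext (by simp) (by intro v; simp; ring)

end Prolong

end Prolongation

section DiffTensor

variable {K : Type*} [Field K] [Differential K]
  {R S : Type*} [CommRing R] [Algebra K R] [Differential R] [DifferentialAlgebra K R]
  [CommRing S] [Algebra K S] [Differential S] [DifferentialAlgebra K S]

/-- The tensor product of two differential `K`-algebras, `(a ⊗ b)′ = a′ ⊗ b + a ⊗ b′`. -/
instance : Differential (R ⊗[K] S) where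
  deriv := Derivation.mk' ((derPair K R).tensor (derPair K S)).der.toIntLinearMap (by
    intro x y
    change ((derPair K R).tensor (derPair K S)).der (x * y)
      = x * ((derPair K R).tensor (derPair K S)).der y
        + y * ((derPair K R).tensor (derPair K S)).der x
    induction x with
    | zero => simp
    | add x₁ x₂ h₁ h₂ => simp only [add_mul, map_add, mul_add, h₁, h₂]; abel
    | tmul a b =>
      induction y with
      | zero => simp
      | add y₁ y₂ h₁ h₂ => simp only [add_mul, map_add, mul_add, h₁, h₂]; abel
      | tmul a' b' =>
        simp only [Algebra.TensorProduct.tmul_mul_tmul, LeibnizPair.tensor_der_tmul, derPair_der,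
          derPair_lin, LinearMap.id_apply, Derivation.leibniz, smul_eq_mul, mul_add,
          TensorProduct.add_tmul, TensorProduct.tmul_add]
        rw [mul_comm a' a, mul_comm b' b, mul_comm a' a′, mul_comm b' b′]
        abel)

lemma deriv_eq_tensor_der (x : R ⊗[K] S) :
    x′ = ((derPair K R).tensor (derPair K S)).der x := rfl

lemma deriv_tmul (a : R) (b : S) : (a ⊗ₜ[K] b)′ = a′ ⊗ₜ[K] b + a ⊗ₜ[K] b′ := rfl

instance : DifferentialAlgebra K (R ⊗[K] S) where
  deriv_algebraMap c := by
    rw [Algebra.TensorProduct.algebraMap_apply, Algebra.TensorProduct.algebraMap_apply,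
      deriv_tmul, deriv_algebraMap]
    simp

end DiffTensor

section Hopf

/-- A differential Hopf algebra over the differential field `K`: the comultiplication, the counit
and the coinverse of the commutative Hopf algebra `A` commute with `∂`. -/
class DiffHopfAlgebra (K A : Type*) [Field K] [Differential K] [CommRing A] [HopfAlgebra K A]
    [Differential A] [DifferentialAlgebra K A] : Prop where
  comul_deriv : ∀ a : A, (Coalgebra.comul (R := K) a′ = (Coalgebra.comul (R := K) a)′)
  counit_deriv : ∀ a : A, (Coalgebra.counit (R := K) a′ = (Coalgebra.counit (R := K) a)′)
  antipode_deriv : ∀ a : A, (HopfAlgebra.antipode K a′ = (HopfAlgebra.antipode K a)′)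

/-- `R` is finitely `∂`-generated over `K`: there is a finite set `X` such that `R` is generated as
a `K`-algebra by all the derivatives `∂ⁱ x`, `i ≥ 0`, `x ∈ X`. -/
def FinitelyDiffGenerated (K R : Type*) [Field K] [CommRing R] [Algebra K R] [Differential R] :
    Prop :=
  ∃ X : Finset R,
    Algebra.adjoin K {y : R | ∃ x ∈ X, ∃ i : ℕ, y = (fun z : R => z′)^[i] x} = ⊤

end Hopf

section Rep

/-- A differential representation of the group `G` with differential Hopf algebra `A`: a finite
dimensional `K`-space `V` with a coaction `ρ : V → V ⊗ A`. -/
structure DiffRep (K A : Type u) [Field K] [CommRing A] [HopfAlgebra K A] where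
  carrier : Type u
  [addCommGroup : AddCommGroup carrier]
  [module : Module K carrier]
  [finite : FiniteDimensional K carrier]
  ρ : carrier →ₗ[K] carrier ⊗[K] A
  coassoc : ∀ v, TensorProduct.assoc K carrier A A (ρ.rTensor A (ρ v))
    = (Coalgebra.comul (R := K)).lTensor carrier (ρ v)
  counit : ∀ v, (Coalgebra.counit (R := K)).lTensor carrier (ρ v) = v ⊗ₜ[K] (1 : K)

attribute [instance] DiffRep.addCommGroup DiffRep.module DiffRep.finite

variable {K A : Type u} [Field K] [CommRing A] [HopfAlgebra K A]

/-- The action of a point `g ∈ G(B) = Hom(A, B)` on the vectors `v = v ⊗ 1` of `V ⊗ B`,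
`r_V(g) v = (id ⊗ g)(ρ v)`. -/
def DiffRep.action (V : DiffRep K A) {B : Type*} [CommRing B] [Algebra K B] (g : A →ₐ[K] B) :
    V.carrier →ₗ[K] V.carrier ⊗[K] B :=
  g.toLinearMap.lTensor V.carrier ∘ₗ V.ρ

/-- A `G`-morphism: a linear map that commutes with the coactions. -/
@[ext]
structure DiffRep.Hom (V W : DiffRep K A) where
  lin : V.carrier →ₗ[K] W.carrier
  comm : ∀ v, W.ρ (lin v) = lin.rTensor A (V.ρ v)

/-- The matrix coefficients `ψ_V : V ⊗ V* → A`, `ψ_V(v ⊗ u) = (u ⊗ id)(ρ v)`. -/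
def DiffRep.psi (V : DiffRep K A) : V.carrier ⊗[K] Module.Dual K V.carrier →ₗ[K] A :=
  TensorProduct.lift (LinearMap.mk₂ K
    (fun v u => TensorProduct.lid K A (u.rTensor A (V.ρ v)))
    (by simp) (by simp) (by simp [LinearMap.rTensor_add]) (by simp [LinearMap.rTensor_smul]))

@[simp] lemma DiffRep.psi_tmul (V : DiffRep K A) (v : V.carrier) (u : Module.Dual K V.carrier) :
    V.psi (v ⊗ₜ u) = TensorProduct.lid K A (u.rTensor A (V.ρ v)) := rfl

/-- As a function on `G`, `ψ_V(v ⊗ u)(g) = u(r_V(g) v)` for each `g ∈ G(B)`. -/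
lemma DiffRep.psi_eval (V : DiffRep K A) (v : V.carrier) (u : Module.Dual K V.carrier)
    {B : Type*} [CommRing B] [Algebra K B] (g : A →ₐ[K] B) :
    g (V.psi (v ⊗ₜ u)) = TensorProduct.lid K B (u.rTensor B (V.action g v)) := by
  simp only [psi_tmul, action, LinearMap.comp_apply]
  induction V.ρ v with
  | zero => simp
  | add x y hx hy => simp only [map_add, hx, hy]
  | tmul x a => simp

/-- The trivial representation `1`. -/
@[reducible] def DiffRep.trivial : DiffRep K A where
  carrier := K
  ρ := (TensorProduct.mk K K A).flip 1
  coassoc v := by simp [Algebra.TensorProduct.one_def]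
  counit v := by simp

section Tensor

variable {V W R S : Type*} [AddCommGroup V] [Module K V] [AddCommGroup W] [Module K W]
  [CommRing R] [Algebra K R] [CommRing S] [Algebra K S]

variable (K V W R) in
/-- `(v ⊗ a) ⊗ (w ⊗ b) ↦ (v ⊗ w) ⊗ a b`. -/
def tmulMap : (V ⊗[K] R) ⊗[K] (W ⊗[K] R) →ₗ[K] (V ⊗[K] W) ⊗[K] R :=
  (LinearMap.mul' K R).lTensor (V ⊗[K] W) ∘ₗ
    (TensorProduct.tensorTensorTensorComm K V R W R).toLinearMap

@[simp] lemma tmulMap_tmul (v : V) (w : W) (a b : R) :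
    tmulMap K V W R ((v ⊗ₜ a) ⊗ₜ (w ⊗ₜ b)) = (v ⊗ₜ w) ⊗ₜ (a * b) := rfl

lemma lTensor_tmulMap (f : R →ₐ[K] S) (x : V ⊗[K] R) (y : W ⊗[K] R) :
    f.toLinearMap.lTensor (V ⊗[K] W) (tmulMap K V W R (x ⊗ₜ y))
      = tmulMap K V W S (f.toLinearMap.lTensor V x ⊗ₜ f.toLinearMap.lTensor W y) := by
  induction x with
  | zero => simp
  | add x₁ x₂ h₁ h₂ => simp only [TensorProduct.add_tmul, map_add, h₁, h₂]
  | tmul v a =>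
    induction y with
    | zero => simp
    | add x₁ x₂ h₁ h₂ => simp only [TensorProduct.tmul_add, map_add, h₁, h₂]
    | tmul w b => simp

lemma assoc_tmulMap (x : V ⊗[K] R) (y : W ⊗[K] R) (a b : S) :
    TensorProduct.assoc K (V ⊗[K] W) R S (tmulMap K V W R (x ⊗ₜ y) ⊗ₜ (a * b))
      = tmulMap K V W (R ⊗[K] S) (TensorProduct.assoc K V R S (x ⊗ₜ a)
          ⊗ₜ TensorProduct.assoc K W R S (y ⊗ₜ b)) := by
  induction x with
  | zero => simp
  | add x₁ x₂ h₁ h₂ => simp only [TensorProduct.add_tmul, map_add, h₁, h₂]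
  | tmul v a =>
    induction y with
    | zero => simp
    | add x₁ x₂ h₁ h₂ =>
      simp only [TensorProduct.tmul_add, TensorProduct.add_tmul, map_add, h₁, h₂]
    | tmul w b => simp

end Tensor

section Coaction

variable {V W X : Type*} [AddCommGroup V] [Module K V] [AddCommGroup W] [Module K W]
  [AddCommGroup X] [Module K X]

/-- The coaction on `V ⊗ W`: if `ρ v = ∑ vᵢ ⊗ aᵢ` and `σ w = ∑ wⱼ ⊗ bⱼ`, then
`v ⊗ w ↦ ∑ (vᵢ ⊗ wⱼ) ⊗ aᵢ bⱼ`. -/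
def tensorCoaction (ρ : V →ₗ[K] V ⊗[K] A) (σ : W →ₗ[K] W ⊗[K] A) :
    V ⊗[K] W →ₗ[K] (V ⊗[K] W) ⊗[K] A :=
  tmulMap K V W A ∘ₗ TensorProduct.map ρ σ

@[simp] lemma tensorCoaction_tmul (ρ : V →ₗ[K] V ⊗[K] A) (σ : W →ₗ[K] W ⊗[K] A) (v : V) (w : W) :
    tensorCoaction ρ σ (v ⊗ₜ w) = tmulMap K V W A (ρ v ⊗ₜ σ w) := rfl

lemma assoc_tensorCoaction (ρ : V →ₗ[K] V ⊗[K] A) (σ : W →ₗ[K] W ⊗[K] A)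
    (x : V ⊗[K] A) (y : W ⊗[K] A) :
    TensorProduct.assoc K (V ⊗[K] W) A A
        ((tensorCoaction ρ σ).rTensor A (tmulMap K V W A (x ⊗ₜ y)))
      = tmulMap K V W (A ⊗[K] A) (TensorProduct.assoc K V A A (ρ.rTensor A x)
          ⊗ₜ TensorProduct.assoc K W A A (σ.rTensor A y)) := by
  induction x with
  | zero => simp
  | add x₁ x₂ h₁ h₂ => simp only [TensorProduct.add_tmul, map_add, h₁, h₂]
  | tmul v a =>
    induction y with
    | zero => simp
    | add x₁ x₂ h₁ h₂ => simp only [TensorProduct.tmul_add, map_add, h₁, h₂]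
    | tmul w b => simp [assoc_tmulMap]

lemma tmulMap_rTensor {V' W' : Type*} [AddCommGroup V'] [Module K V'] [AddCommGroup W']
    [Module K W'] (f : V →ₗ[K] V') (g : W →ₗ[K] W') (x : V ⊗[K] A) (y : W ⊗[K] A) :
    tmulMap K V' W' A (f.rTensor A x ⊗ₜ g.rTensor A y)
      = (TensorProduct.map f g).rTensor A (tmulMap K V W A (x ⊗ₜ y)) := by
  induction x with
  | zero => simp
  | add x₁ x₂ h₁ h₂ => simp only [TensorProduct.add_tmul, map_add, h₁, h₂]
  | tmul v a =>
    induction y with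
    | zero => simp
    | add x₁ x₂ h₁ h₂ => simp only [TensorProduct.tmul_add, map_add, h₁, h₂]
    | tmul w b => simp

lemma tmulMap_comm (x : V ⊗[K] A) (y : W ⊗[K] A) :
    tmulMap K W V A (y ⊗ₜ x)
      = (TensorProduct.comm K V W).toLinearMap.rTensor A (tmulMap K V W A (x ⊗ₜ y)) := by
  induction x with
  | zero => simp
  | add x₁ x₂ h₁ h₂ => simp only [TensorProduct.tmul_add, TensorProduct.add_tmul, map_add, h₁, h₂]
  | tmul v a =>
    induction y with
    | zero => simp
    | add x₁ x₂ h₁ h₂ =>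
      simp only [TensorProduct.tmul_add, TensorProduct.add_tmul, map_add, h₁, h₂]
    | tmul w b => simp [mul_comm]

lemma tmulMap_assoc (x : V ⊗[K] A) (y : W ⊗[K] A) (z : X ⊗[K] A) :
    tmulMap K V (W ⊗[K] X) A (x ⊗ₜ tmulMap K W X A (y ⊗ₜ z))
      = (TensorProduct.assoc K V W X).toLinearMap.rTensor A
          (tmulMap K (V ⊗[K] W) X A (tmulMap K V W A (x ⊗ₜ y) ⊗ₜ z)) := by
  induction x with
  | zero => simp
  | add x₁ x₂ h₁ h₂ => simp only [TensorProduct.add_tmul, map_add, h₁, h₂]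
  | tmul v a =>
    induction y with
    | zero => simp
    | add x₁ x₂ h₁ h₂ =>
      simp only [TensorProduct.tmul_add, TensorProduct.add_tmul, map_add, h₁, h₂]
    | tmul w b =>
      induction z with
      | zero => simp
      | add x₁ x₂ h₁ h₂ => simp only [TensorProduct.tmul_add, map_add, h₁, h₂]
      | tmul x c => simp [mul_assoc]

lemma tmulMap_one (x : V ⊗[K] A) :
    tmulMap K V K A (x ⊗ₜ ((1 : K) ⊗ₜ (1 : A)))
      = ((TensorProduct.mk K V K).flip 1).rTensor A x := by
  induction x with
  | zero => simp
  | add x y hx hy => simp only [TensorProduct.add_tmul, map_add, hx, hy]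
  | tmul v a => simp

end Coaction

/-- The tensor product of representations. -/
@[reducible] def DiffRep.tensor (V W : DiffRep K A) : DiffRep K A where
  carrier := V.carrier ⊗[K] W.carrier
  ρ := tensorCoaction V.ρ W.ρ
  coassoc z := by
    induction z with
    | zero => simp
    | add x y hx hy => simp only [map_add, hx, hy]
    | tmul v w =>
      rw [tensorCoaction_tmul, assoc_tensorCoaction, V.coassoc, W.coassoc]
      exact (lTensor_tmulMap (Bialgebra.comulAlgHom K A) _ _).symm
  counit z := by
    induction z with
    | zero => simp
    | add x y hx hy => simp only [map_add, hx, hy, TensorProduct.add_tmul]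
    | tmul v w =>
      rw [tensorCoaction_tmul]
      refine (lTensor_tmulMap (Bialgebra.counitAlgHom K A) _ _).trans ?_
      simp only [Bialgebra.toLinearMap_counitAlgHom]
      rw [V.counit, W.counit]
      simp

end Rep

section RepProlong

variable {K A : Type u} [Field K] [Differential K] [CommRing A] [HopfAlgebra K A]
  [Differential A] [DifferentialAlgebra K A]

section

variable {V R S : Type*} [AddCommGroup V] [Module K V]
  [CommRing R] [Algebra K R] [Differential R] [DifferentialAlgebra K R]
  [CommRing S] [Algebra K S] [Differential S] [DifferentialAlgebra K S]

variable (K V R) in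
/-- `∂ : V ⊗ R → V⁽¹⁾ ⊗ R`, `∂(v ⊗ a) = ∂v ⊗ a + v ⊗ a′`, over the inclusion. -/
def tensorDer : LeibnizPair K (V ⊗[K] R) (Prolong V ⊗[K] R) :=
  (Prolong.pair K V).tensor (derPair K R)

@[simp] lemma tensorDer_der_tmul (v : V) (a : R) : (tensorDer K V R).der (v ⊗ₜ a)
    = Prolong.der V v ⊗ₜ a + Prolong.incl K V v ⊗ₜ a′ := rfl

lemma tensorDer_lin : (tensorDer K V R).lin = (Prolong.incl K V).rTensor R := rfl

lemma lTensor_tensorDer (f : R →ₗ[K] S) (hf : ∀ a, f a′ = (f a)′) (x : V ⊗[K] R) :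
    f.lTensor (Prolong V) ((tensorDer K V R).der x)
      = (tensorDer K V S).der (f.lTensor V x) := by
  induction x with
  | zero => simp
  | add x y hx hy => simp only [map_add, hx, hy]
  | tmul v a => simp [hf]

lemma assoc_tensorDer (x : V ⊗[K] R) (a : S) :
    TensorProduct.assoc K (Prolong V) R S ((tensorDer K V R).der x ⊗ₜ a
        + (Prolong.incl K V).rTensor R x ⊗ₜ a′)
      = (tensorDer K V (R ⊗[K] S)).der (TensorProduct.assoc K V R S (x ⊗ₜ a)) := by
  induction x with
  | zero => simp
  | add x y hx hy =>
    simp only [map_add, TensorProduct.add_tmul] at hx hy ⊢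
    rw [← hx, ← hy]; abel
  | tmul v b =>
    simp only [tensorDer_der_tmul, TensorProduct.add_tmul, map_add, LinearMap.rTensor_tmul,
      TensorProduct.assoc_tmul, deriv_tmul, TensorProduct.tmul_add]
    abel

lemma lTensor_incl {N P : Type*} [AddCommGroup N] [Module K N] [AddCommGroup P] [Module K P]
    (f : N →ₗ[K] P) (x : V ⊗[K] N) :
    f.lTensor (Prolong V) ((Prolong.incl K V).rTensor N x)
      = (Prolong.incl K V).rTensor P (f.lTensor V x) := by
  induction x with
  | zero => simp
  | add x y hx hy => simp only [map_add, hx, hy]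
  | tmul v a => simp

end

section

variable {V W : Type*} [AddCommGroup V] [Module K V] [AddCommGroup W] [Module K W]

/-- The prolongation of a coaction to `V⁽¹⁾`: `1 ⊗ v ↦ ρ(v)` in `V ⊗ A ⊆ V⁽¹⁾ ⊗ A`, and
`∂ ⊗ v ↦ ∂(ρ(v))`; so `ρ v = ∑ vᵢ ⊗ aᵢ` gives `∂v ↦ ∑ (∂vᵢ ⊗ aᵢ + vᵢ ⊗ aᵢ′)`. -/
def prolongCoaction (ρ : V →ₗ[K] V ⊗[K] A) : Prolong V →ₗ[K] Prolong V ⊗[K] A :=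
  Prolong.lift ((tensorDer K V A).comp ρ)

@[simp] lemma prolongCoaction_incl (ρ : V →ₗ[K] V ⊗[K] A) (v : V) :
    prolongCoaction ρ (Prolong.incl K V v) = (Prolong.incl K V).rTensor A (ρ v) := by
  rw [prolongCoaction, Prolong.lift_incl]; rfl

@[simp] lemma prolongCoaction_der (ρ : V →ₗ[K] V ⊗[K] A) (v : V) :
    prolongCoaction ρ (Prolong.der V v) = (tensorDer K V A).der (ρ v) := by
  rw [prolongCoaction, Prolong.lift_der]; rfl

lemma assoc_prolongCoaction_incl (ρ : V →ₗ[K] V ⊗[K] A) (x : V ⊗[K] A) :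
    TensorProduct.assoc K (Prolong V) A A
        ((prolongCoaction ρ).rTensor A ((Prolong.incl K V).rTensor A x))
      = (Prolong.incl K V).rTensor (A ⊗[K] A)
          (TensorProduct.assoc K V A A (ρ.rTensor A x)) := by
  induction x with
  | zero => simp
  | add x y hx hy => simp only [map_add, hx, hy]
  | tmul v a =>
    simp only [LinearMap.rTensor_tmul, prolongCoaction_incl]
    induction ρ v with
    | zero => simp
    | add x y hx hy => simp only [map_add, TensorProduct.add_tmul, hx, hy]
    | tmul v b => simp

lemma assoc_prolongCoaction_der (ρ : V →ₗ[K] V ⊗[K] A) (x : V ⊗[K] A) :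
    TensorProduct.assoc K (Prolong V) A A
        ((prolongCoaction ρ).rTensor A ((tensorDer K V A).der x))
      = (tensorDer K V (A ⊗[K] A)).der (TensorProduct.assoc K V A A (ρ.rTensor A x)) := by
  induction x with
  | zero => simp
  | add x y hx hy => simp only [map_add, hx, hy]
  | tmul v a =>
    simp only [tensorDer_der_tmul, map_add, LinearMap.rTensor_tmul, prolongCoaction_incl,
      prolongCoaction_der]
    rw [← assoc_tensorDer, map_add]

lemma proj_prolongCoaction (ρ : V →ₗ[K] V ⊗[K] A) :
    ρ ∘ₗ Prolong.proj K V = (Prolong.proj K V).rTensor A ∘ₗ prolongCoaction ρ := by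
  apply Prolong.hom_ext
  · intro v
    simp only [LinearMap.comp_apply, Prolong.proj_incl, map_zero, prolongCoaction_incl]
    induction ρ v with
    | zero => simp
    | add x y hx hy => simp only [map_add, ← hx, ← hy, add_zero]
    | tmul v b => simp
  · intro v
    simp only [LinearMap.comp_apply, Prolong.proj_der, prolongCoaction_der]
    induction ρ v with
    | zero => simp
    | add x y hx hy => simp only [map_add, ← hx, ← hy]
    | tmul v b => simp

lemma map_prolongCoaction (ρ : V →ₗ[K] V ⊗[K] A) (σ : W →ₗ[K] W ⊗[K] A) (φ : V →ₗ[K] W)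
    (h : ∀ v, σ (φ v) = φ.rTensor A (ρ v)) :
    prolongCoaction σ ∘ₗ Prolong.map φ = (Prolong.map φ).rTensor A ∘ₗ prolongCoaction ρ := by
  apply Prolong.hom_ext
  · intro v
    simp only [LinearMap.comp_apply, Prolong.map_incl, prolongCoaction_incl, h]
    induction ρ v with
    | zero => simp
    | add x y hx hy => simp only [map_add, hx, hy]
    | tmul v b => simp
  · intro v
    simp only [LinearMap.comp_apply, Prolong.map_der, prolongCoaction_der, h]
    induction ρ v with
    | zero => simp
    | add x y hx hy => simp only [map_add, hx, hy]
    | tmul v b => simp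

variable (K V W) in
/-- The linear map `(V ⊗ W)⁽¹⁾ → V⁽¹⁾ ⊗ W⁽¹⁾` with `1 ⊗ (v ⊗ w) ↦ v ⊗ w` and
`∂ ⊗ (v ⊗ w) ↦ ∂v ⊗ w + v ⊗ ∂w`. -/
def leibnizMap : Prolong (V ⊗[K] W) →ₗ[K] Prolong V ⊗[K] Prolong W :=
  Prolong.lift ((Prolong.pair K V).tensor (Prolong.pair K W))

@[simp] lemma leibnizMap_incl (v : V) (w : W) :
    leibnizMap K V W (Prolong.incl K _ (v ⊗ₜ w))
      = Prolong.incl K V v ⊗ₜ Prolong.incl K W w := by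
  rw [leibnizMap, Prolong.lift_incl]; rfl

@[simp] lemma leibnizMap_der (v : V) (w : W) :
    leibnizMap K V W (Prolong.der _ (v ⊗ₜ w))
      = Prolong.der V v ⊗ₜ Prolong.incl K W w + Prolong.incl K V v ⊗ₜ Prolong.der W w := by
  rw [leibnizMap, Prolong.lift_der]; rfl

set_option linter.unusedSectionVars false in
lemma leibnizMap_tmulMap_incl (x : V ⊗[K] A) (y : W ⊗[K] A) :
    (leibnizMap K V W).rTensor A ((Prolong.incl K (V ⊗[K] W)).rTensor A
        (tmulMap K V W A (x ⊗ₜ y)))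
      = tmulMap K (Prolong V) (Prolong W) A
          ((Prolong.incl K V).rTensor A x ⊗ₜ (Prolong.incl K W).rTensor A y) := by
  induction x with
  | zero => simp
  | add x₁ x₂ h₁ h₂ => simp only [TensorProduct.add_tmul, map_add, h₁, h₂]
  | tmul v a =>
    induction y with
    | zero => simp
    | add x₁ x₂ h₁ h₂ => simp only [TensorProduct.tmul_add, map_add, h₁, h₂]
    | tmul w b => simp

lemma leibnizMap_tmulMap_der (x : V ⊗[K] A) (y : W ⊗[K] A) :
    (leibnizMap K V W).rTensor A ((tensorDer K (V ⊗[K] W) A).der (tmulMap K V W A (x ⊗ₜ y)))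
      = tmulMap K (Prolong V) (Prolong W) A
          ((tensorDer K V A).der x ⊗ₜ (Prolong.incl K W).rTensor A y
            + (Prolong.incl K V).rTensor A x ⊗ₜ (tensorDer K W A).der y) := by
  induction x with
  | zero => simp
  | add x₁ x₂ h₁ h₂ => simp only [TensorProduct.add_tmul, map_add, h₁, h₂]; abel
  | tmul v a =>
    induction y with
    | zero => simp
    | add x₁ x₂ h₁ h₂ => simp only [TensorProduct.tmul_add, map_add, h₁, h₂]; abel
    | tmul w b =>
      simp only [tmulMap_tmul, tensorDer_der_tmul, map_add, LinearMap.rTensor_tmul,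
        leibnizMap_incl, leibnizMap_der, TensorProduct.add_tmul, TensorProduct.tmul_add,
        Derivation.leibniz, smul_eq_mul, mul_comm b a′]
      abel

lemma leibnizMap_coaction (ρ : V →ₗ[K] V ⊗[K] A) (σ : W →ₗ[K] W ⊗[K] A) :
    tensorCoaction (prolongCoaction ρ) (prolongCoaction σ) ∘ₗ leibnizMap K V W
      = (leibnizMap K V W).rTensor A ∘ₗ prolongCoaction (tensorCoaction ρ σ) := by
  apply Prolong.hom_ext
  · intro x
    simp only [LinearMap.comp_apply, prolongCoaction_incl]
    induction x with
    | zero => simp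
    | add x y hx hy => simp only [map_add, hx, hy]
    | tmul v w => simp [leibnizMap_tmulMap_incl]
  · intro x
    simp only [LinearMap.comp_apply, prolongCoaction_der]
    induction x with
    | zero => simp
    | add x y hx hy => simp only [map_add, hx, hy]
    | tmul v w => simp [leibnizMap_tmulMap_der]

end

variable [DiffHopfAlgebra K A]

/-- The prolongation `V⁽¹⁾` of a representation. -/
@[reducible] def DiffRep.prolong (V : DiffRep K A) : DiffRep K A where
  carrier := Prolong V.carrier
  ρ := prolongCoaction V.ρ
  coassoc z := by
    rw [Prolong.eq_incl_add_der K z]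
    simp only [map_add, prolongCoaction_incl, prolongCoaction_der, assoc_prolongCoaction_incl,
      assoc_prolongCoaction_der, V.coassoc]
    rw [lTensor_incl, lTensor_tensorDer _ DiffHopfAlgebra.comul_deriv]
  counit z := by
    rw [Prolong.eq_incl_add_der K z]
    simp only [map_add, prolongCoaction_incl, prolongCoaction_der]
    rw [lTensor_incl, lTensor_tensorDer _ DiffHopfAlgebra.counit_deriv, V.counit, V.counit]
    simp [TensorProduct.add_tmul]

end RepProlong

section Hom

variable {K A : Type u} [Field K] [CommRing A] [HopfAlgebra K A]

namespace DiffRep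

/-- The flip `V ⊗ W → W ⊗ V`. -/
def commHom (V W : DiffRep K A) : Hom (V.tensor W) (W.tensor V) where
  lin := (TensorProduct.comm K V.carrier W.carrier).toLinearMap
  comm := LinearMap.congr_fun
    (f := tensorCoaction W.ρ V.ρ ∘ₗ (TensorProduct.comm K V.carrier W.carrier).toLinearMap)
    (g := (TensorProduct.comm K V.carrier W.carrier).toLinearMap.rTensor A ∘ₗ
      tensorCoaction V.ρ W.ρ)
    (TensorProduct.ext' fun v w => tmulMap_comm (V.ρ v) (W.ρ w))

/-- The associator `(V ⊗ W) ⊗ X → V ⊗ (W ⊗ X)`. -/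
def assocHom (V W X : DiffRep K A) : Hom ((V.tensor W).tensor X) (V.tensor (W.tensor X)) where
  lin := (TensorProduct.assoc K V.carrier W.carrier X.carrier).toLinearMap
  comm := LinearMap.congr_fun
    (f := tensorCoaction V.ρ (tensorCoaction W.ρ X.ρ) ∘ₗ
      (TensorProduct.assoc K V.carrier W.carrier X.carrier).toLinearMap)
    (g := (TensorProduct.assoc K V.carrier W.carrier X.carrier).toLinearMap.rTensor A ∘ₗ
      tensorCoaction (tensorCoaction V.ρ W.ρ) X.ρ)
    (TensorProduct.ext_threefold fun v w x => tmulMap_assoc (V.ρ v) (W.ρ w) (X.ρ x))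

/-- The morphism `V → V ⊗ 1`, `v ↦ v ⊗ e`. -/
def unitHom (V : DiffRep K A) : Hom V (V.tensor trivial) where
  lin := (TensorProduct.mk K V.carrier K).flip 1
  comm v := tmulMap_one (V.ρ v)

/-- The tensor product of two morphisms. -/
def Hom.tensor {V V' W W' : DiffRep K A} (φ : Hom V V') (χ : Hom W W') :
    Hom (V.tensor W) (V'.tensor W') where
  lin := TensorProduct.map φ.lin χ.lin
  comm := LinearMap.congr_fun
    (f := tensorCoaction V'.ρ W'.ρ ∘ₗ TensorProduct.map φ.lin χ.lin)
    (g := (TensorProduct.map φ.lin χ.lin).rTensor A ∘ₗ tensorCoaction V.ρ W.ρ)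
    (TensorProduct.ext' fun v w => by
      simp only [LinearMap.comp_apply, TensorProduct.map_tmul, tensorCoaction_tmul, φ.comm, χ.comm,
        tmulMap_rTensor])

/-- The identity morphism. -/
def Hom.id (V : DiffRep K A) : Hom V V where
  lin := LinearMap.id
  comm v := by simp

variable [Differential K] [Differential A] [DifferentialAlgebra K A] [DiffHopfAlgebra K A]

/-- The inclusion `V → V⁽¹⁾` as a morphism. -/
def inclHom (V : DiffRep K A) : Hom V V.prolong where
  lin := Prolong.incl K V.carrier
  comm v := prolongCoaction_incl V.ρ v

/-- The projection `V⁽¹⁾ → V`, `1 ⊗ v ↦ 0`, `∂ ⊗ v ↦ v`, as a morphism. -/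
def projHom (V : DiffRep K A) : Hom V.prolong V where
  lin := Prolong.proj K V.carrier
  comm := LinearMap.congr_fun (proj_prolongCoaction V.ρ)

/-- The prolongation of a morphism. -/
def Hom.prolong {V W : DiffRep K A} (φ : Hom V W) : Hom V.prolong W.prolong where
  lin := Prolong.map φ.lin
  comm := LinearMap.congr_fun (map_prolongCoaction V.ρ W.ρ φ.lin φ.comm)

/-- The morphism `(V ⊗ W)⁽¹⁾ → V⁽¹⁾ ⊗ W⁽¹⁾`. -/
def leibnizHom (V W : DiffRep K A) :
    Hom (V.tensor W).prolong (V.prolong.tensor W.prolong) where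
  lin := leibnizMap K V.carrier W.carrier
  comm := LinearMap.congr_fun (leibnizMap_coaction V.ρ W.ρ)

end DiffRep

end Hom

section Recovered

variable (K A : Type u) [Field K] [CommRing A] [HopfAlgebra K A]

/-- `𝓕 = ⨁_V V ⊗ V*`, the sum over all the representations `V` of `G`. -/
abbrev RepSum : Type (u + 1) :=
  DirectSum (DiffRep K A) fun V => V.carrier ⊗[K] Module.Dual K V.carrier

variable {K A} in
open scoped Classical in
/-- The canonical injection `i_V : V ⊗ V* → 𝓕`. -/
def DiffRep.inj (V : DiffRep K A) : V.carrier ⊗[K] Module.Dual K V.carrier →ₗ[K] RepSum K A :=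
  DirectSum.lof K (DiffRep K A) (fun V => V.carrier ⊗[K] Module.Dual K V.carrier) V

/-- The subspace spanned by the `i_V (id ⊗ φ*)(z) - i_W (φ ⊗ id)(z)`, for all `G`-morphisms
`φ : V → W` and all `z ∈ V ⊗ W*`. -/
def relations : Submodule K (RepSum K A) :=
  Submodule.span K {x | ∃ (V W : DiffRep K A) (φ : V.Hom W)
    (z : V.carrier ⊗[K] Module.Dual K W.carrier),
    x = V.inj (φ.lin.dualMap.lTensor V.carrier z)
      - W.inj (φ.lin.rTensor (Module.Dual K W.carrier) z)}

/-- The quotient `𝒜` of `⨁_V V ⊗ V*` by the relations coming from the `G`-morphisms. -/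
def Recovered : Type (u + 1) := RepSum K A ⧸ relations K A

namespace Recovered

instance : AddCommGroup (Recovered K A) := inferInstanceAs (AddCommGroup (_ ⧸ relations K A))

instance : Module K (Recovered K A) := inferInstanceAs (Module K (_ ⧸ relations K A))

variable {K A}

/-- `a_V : V ⊗ V* → 𝒜`. -/
def a (V : DiffRep K A) : V.carrier ⊗[K] Module.Dual K V.carrier →ₗ[K] Recovered K A :=
  (relations K A).mkQ ∘ₗ V.inj

lemma a_hom {V W : DiffRep K A} (φ : V.Hom W) (v : V.carrier) (u : Module.Dual K W.carrier) :
    a V (v ⊗ₜ (u ∘ₗ φ.lin)) = a W (φ.lin v ⊗ₜ u) := by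
  refine (Submodule.Quotient.eq (relations K A)).2 (Submodule.subset_span ?_)
  exact ⟨V, W, φ, v ⊗ₜ u, rfl⟩

/-- An additive map out of `𝒜`, from a compatible family of additive maps. -/
def liftAdd {N : Type*} [AddCommGroup N]
    (f : ∀ V : DiffRep K A, V.carrier ⊗[K] Module.Dual K V.carrier →+ N)
    (hf : ∀ (V W : DiffRep K A) (φ : V.Hom W) (v : V.carrier) (u : Module.Dual K W.carrier),
      f V (v ⊗ₜ (u ∘ₗ φ.lin)) = f W (φ.lin v ⊗ₜ u)) : Recovered K A →+ N :=
  QuotientAddGroup.lift (relations K A).toAddSubgroup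
    (by classical exact DirectSum.toAddMonoid f) (by
      classical
      have key : ∀ (V W : DiffRep K A) (φ : V.Hom W)
          (z : V.carrier ⊗[K] Module.Dual K W.carrier),
          DirectSum.toAddMonoid f (V.inj (φ.lin.dualMap.lTensor V.carrier z)
            - W.inj (φ.lin.rTensor (Module.Dual K W.carrier) z)) = 0 := by
        intro V W φ z
        induction z with
        | zero => simp
        | add x y hx hy =>
          rw [map_add, map_add, map_add, map_add, add_sub_add_comm, map_add, hx, hy, add_zero]
        | tmul v u =>
          rw [map_sub, sub_eq_zero]
          refine ((DirectSum.toAddMonoid_of _ _ _).trans ?_).trans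
            (DirectSum.toAddMonoid_of _ _ _).symm
          exact hf V W φ v u
      intro x hx
      change x ∈ relations K A at hx
      have : ∀ c : K, DirectSum.toAddMonoid f (c • x) = 0 := by
        refine Submodule.span_induction ?_ ?_ ?_ ?_ hx
        · rintro _ ⟨V, W, φ, z, rfl⟩ c
          have := key V W φ (c • z)
          rw [map_smul, map_smul, map_smul, map_smul] at this
          rw [smul_sub]
          exact this
        · simp
        · intro x y _ _ hx hy c
          rw [smul_add, map_add, hx, hy, add_zero]
        · intro b x _ hx c
          rw [smul_smul]; exact hx _
      simpa using this 1)

lemma liftAdd_a {N : Type*} [AddCommGroup N]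
    (f : ∀ V : DiffRep K A, V.carrier ⊗[K] Module.Dual K V.carrier →+ N)
    (hf : ∀ (V W : DiffRep K A) (φ : V.Hom W) (v : V.carrier) (u : Module.Dual K W.carrier),
      f V (v ⊗ₜ (u ∘ₗ φ.lin)) = f W (φ.lin v ⊗ₜ u)) (V : DiffRep K A)
    (z : V.carrier ⊗[K] Module.Dual K V.carrier) : liftAdd f hf (a V z) = f V z := by
  classical exact DirectSum.toAddMonoid_of _ _ _

lemma induction_on {p : Recovered K A → Prop} (x : Recovered K A) (h0 : p 0)
    (ha : ∀ (V : DiffRep K A) (v : V.carrier) (u : Module.Dual K V.carrier), p (a V (v ⊗ₜ u)))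
    (hadd : ∀ x y, p x → p y → p (x + y)) : p x := by
  classical
  obtain ⟨y, rfl⟩ := (relations K A).mkQ_surjective x
  induction y using DirectSum.induction_on with
  | zero => rw [map_zero]; exact h0
  | add x y hx hy => rw [map_add]; exact hadd _ _ hx hy
  | of V z =>
    change p (a V z)
    induction z with
    | zero => simpa using h0
    | add x y hx hy => rw [map_add]; exact hadd _ _ hx hy
    | tmul v u => exact ha V v u

/-- A linear map out of `𝒜`, from a compatible family of linear maps. -/
def lift {N : Type*} [AddCommGroup N] [Module K N]
    (f : ∀ V : DiffRep K A, V.carrier ⊗[K] Module.Dual K V.carrier →ₗ[K] N)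
    (hf : ∀ (V W : DiffRep K A) (φ : V.Hom W) (v : V.carrier) (u : Module.Dual K W.carrier),
      f V (v ⊗ₜ (u ∘ₗ φ.lin)) = f W (φ.lin v ⊗ₜ u)) : Recovered K A →ₗ[K] N where
  toFun := liftAdd (fun V => (f V).toAddMonoidHom) (fun V W φ v u => by simpa using hf V W φ v u)
  map_add' := map_add _
  map_smul' c x := by
    induction x using induction_on with
    | h0 => simp
    | ha V v u =>
      refine (congrArg _ (map_smul (a V) c (v ⊗ₜ u)).symm).trans ?_
      refine (liftAdd_a _ _ V _).trans ?_
      refine (map_smul (f V) c _).trans ?_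
      exact congrArg (c • ·) (liftAdd_a (fun V => (f V).toAddMonoidHom) _ V (v ⊗ₜ u)).symm
    | hadd x y hx hy => rw [smul_add, map_add, map_add, hx, hy, smul_add]

@[simp] lemma lift_a {N : Type*} [AddCommGroup N] [Module K N]
    (f : ∀ V : DiffRep K A, V.carrier ⊗[K] Module.Dual K V.carrier →ₗ[K] N)
    (hf : ∀ (V W : DiffRep K A) (φ : V.Hom W) (v : V.carrier) (u : Module.Dual K W.carrier),
      f V (v ⊗ₜ (u ∘ₗ φ.lin)) = f W (φ.lin v ⊗ₜ u)) (V : DiffRep K A)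
    (z : V.carrier ⊗[K] Module.Dual K V.carrier) : lift f hf (a V z) = f V z :=
  liftAdd_a (fun V => (f V).toAddMonoidHom) (fun V W φ v u => by simpa using hf V W φ v u) V z

/-- `(v ⊗ u, w ⊗ t) ↦ a_{V ⊗ W}((v ⊗ w) ⊗ (u ⊗ t))`, where `(u ⊗ t)(v ⊗ w) = u(v) t(w)`. -/
def mulAux (V W : DiffRep K A) : V.carrier ⊗[K] Module.Dual K V.carrier →ₗ[K]
    W.carrier ⊗[K] Module.Dual K W.carrier →ₗ[K] Recovered K A :=
  TensorProduct.curry (a (V.tensor W) ∘ₗ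
    (TensorProduct.dualDistrib K V.carrier W.carrier).lTensor (V.carrier ⊗[K] W.carrier) ∘ₗ
    (TensorProduct.tensorTensorTensorComm K V.carrier (Module.Dual K V.carrier) W.carrier
      (Module.Dual K W.carrier)).toLinearMap)

lemma mulAux_tmul (V W : DiffRep K A) (v : V.carrier) (u : Module.Dual K V.carrier)
    (w : W.carrier) (t : Module.Dual K W.carrier) :
    mulAux V W (v ⊗ₜ u) (w ⊗ₜ t)
      = a (V.tensor W) ((v ⊗ₜ w) ⊗ₜ TensorProduct.dualDistrib K _ _ (u ⊗ₜ t)) := rfl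

lemma mulAux_hom {V V' W W' : DiffRep K A} (φ : V.Hom V') (χ : W.Hom W') (v : V.carrier)
    (u : Module.Dual K V'.carrier) (w : W.carrier) (t : Module.Dual K W'.carrier) :
    mulAux V W (v ⊗ₜ (u ∘ₗ φ.lin)) (w ⊗ₜ (t ∘ₗ χ.lin))
      = mulAux V' W' (φ.lin v ⊗ₜ u) (χ.lin w ⊗ₜ t) := by
  rw [mulAux_tmul, mulAux_tmul]
  refine Eq.trans ?_
    (a_hom (φ.tensor χ) (v ⊗ₜ w) (TensorProduct.dualDistrib K _ _ (u ⊗ₜ t)))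
  congr 2
  exact TensorProduct.ext' fun _ _ => rfl

/-- The product of `𝒜`. -/
def mulLin : Recovered K A →ₗ[K] Recovered K A →ₗ[K] Recovered K A :=
  lift (fun V => (lift (fun W => (mulAux V W).flip) (fun W W' χ w t => by
      refine TensorProduct.ext' fun v u => ?_
      exact mulAux_hom (DiffRep.Hom.id V) χ v u w t)).flip)
    (fun V V' φ v u => by
      refine LinearMap.ext fun x => ?_
      induction x using induction_on with
      | h0 => simp
      | ha W w t =>
        simp only [LinearMap.flip_apply, lift_a]
        exact mulAux_hom φ (DiffRep.Hom.id W) v u w t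
      | hadd x y hx hy => rw [map_add, map_add, hx, hy])

lemma mulLin_a (V W : DiffRep K A) (v : V.carrier) (u : Module.Dual K V.carrier)
    (w : W.carrier) (t : Module.Dual K W.carrier) :
    mulLin (a V (v ⊗ₜ u)) (a W (w ⊗ₜ t))
      = a (V.tensor W) ((v ⊗ₜ w) ⊗ₜ TensorProduct.dualDistrib K _ _ (u ⊗ₜ t)) := by
  simp only [mulLin, lift_a, LinearMap.flip_apply]
  exact mulAux_tmul V W v u w t

instance : Mul (Recovered K A) := ⟨fun x y => mulLin x y⟩

/-- The unit is `a_1(e ⊗ e*)` for the trivial representation. -/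
instance : One (Recovered K A) :=
  ⟨a DiffRep.trivial ((1 : K) ⊗ₜ (LinearMap.id : K →ₗ[K] K))⟩

lemma mul_def (x y : Recovered K A) : x * y = mulLin x y := rfl

/-- `a_V(v ⊗ u) a_W(w ⊗ t) = a_{V ⊗ W}((v ⊗ w) ⊗ (u ⊗ t))`. -/
lemma a_mul_a (V W : DiffRep K A) (v : V.carrier) (u : Module.Dual K V.carrier)
    (w : W.carrier) (t : Module.Dual K W.carrier) :
    a V (v ⊗ₜ u) * a W (w ⊗ₜ t)
      = a (V.tensor W) ((v ⊗ₜ w) ⊗ₜ TensorProduct.dualDistrib K _ _ (u ⊗ₜ t)) :=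
  mulLin_a V W v u w t

lemma one_def : (1 : Recovered K A)
    = a DiffRep.trivial ((1 : K) ⊗ₜ (LinearMap.id : K →ₗ[K] K)) := rfl

lemma mul_comm_aux (x y : Recovered K A) : x * y = y * x := by
  induction x using induction_on with
  | h0 => simp [mul_def]
  | hadd x x' hx hx' => simp only [mul_def, map_add, LinearMap.add_apply] at hx hx' ⊢; rw [hx, hx']
  | ha V v u =>
    induction y using induction_on with
    | h0 => simp [mul_def]
    | hadd x x' hx hx' =>
      simp only [mul_def, map_add, LinearMap.add_apply] at hx hx' ⊢; rw [hx, hx']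
    | ha W w t =>
      rw [a_mul_a, a_mul_a]
      refine Eq.trans ?_
        (a_hom (DiffRep.commHom V W) (v ⊗ₜ w) (TensorProduct.dualDistrib K _ _ (t ⊗ₜ u)))
      congr 2
      exact TensorProduct.ext' fun x y => mul_comm (u x) (t y)

lemma mul_assoc_aux (x y z : Recovered K A) : x * y * z = x * (y * z) := by
  induction x using induction_on with
  | h0 => simp [mul_def]
  | hadd x x' hx hx' => simp only [mul_def, map_add, LinearMap.add_apply] at hx hx' ⊢; rw [hx, hx']
  | ha V v u =>
    induction y using induction_on with
    | h0 => simp [mul_def]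
    | hadd x x' hx hx' =>
      simp only [mul_def, map_add, LinearMap.add_apply] at hx hx' ⊢; rw [hx, hx']
    | ha W w t =>
      induction z using induction_on with
      | h0 => simp [mul_def]
      | hadd x x' hx hx' =>
        simp only [mul_def, map_add] at hx hx' ⊢; rw [hx, hx']
      | ha X x s =>
        rw [a_mul_a, a_mul_a, a_mul_a, a_mul_a]
        refine Eq.trans ?_
          (a_hom (DiffRep.assocHom V W X) ((v ⊗ₜ w) ⊗ₜ x)
            (TensorProduct.dualDistrib K _ _ (u ⊗ₜ TensorProduct.dualDistrib K _ _ (t ⊗ₜ s))))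
        congr 2
        exact TensorProduct.ext_threefold fun x y z => mul_assoc (u x) (t y) (s z)

lemma mul_one_aux (x : Recovered K A) : x * 1 = x := by
  induction x using induction_on with
  | h0 => simp [mul_def]
  | hadd x x' hx hx' => simp only [mul_def, map_add, LinearMap.add_apply] at hx hx' ⊢; rw [hx, hx']
  | ha V v u =>
    rw [one_def, a_mul_a]
    refine (a_hom (DiffRep.unitHom V) v
      (TensorProduct.dualDistrib K _ _ (u ⊗ₜ (LinearMap.id : K →ₗ[K] K)))).symm.trans ?_
    congr 2
    exact LinearMap.ext fun x => mul_one (u x)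

instance : CommRing (Recovered K A) :=
  { (inferInstance : AddCommGroup (Recovered K A)), (inferInstance : Mul (Recovered K A)),
    (inferInstance : One (Recovered K A)) with
    left_distrib := fun x y z => map_add (mulLin x) y z
    right_distrib := fun x y z => by
      change mulLin (x + y) z = mulLin x z + mulLin y z
      rw [map_add, LinearMap.add_apply]
    zero_mul := fun x => by change mulLin 0 x = 0; simp
    mul_zero := fun x => map_zero (mulLin x)
    mul_assoc := mul_assoc_aux
    one_mul := fun x => by rw [mul_comm_aux, mul_one_aux]
    mul_one := mul_one_aux
    mul_comm := mul_comm_aux }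

instance : Algebra K (Recovered K A) :=
  Algebra.ofModule
    (fun c x y => by
      change mulLin (c • x) y = c • mulLin x y
      rw [map_smul, LinearMap.smul_apply])
    (fun c x y => map_smul (mulLin x) c y)

variable [Differential K] [Differential A] [DifferentialAlgebra K A] [DiffHopfAlgebra K A]

/-- `v ⊗ u ↦ a_{V⁽¹⁾}(∂v ⊗ F(u))`. -/
def derAux (V : DiffRep K A) : V.carrier ⊗[K] Module.Dual K V.carrier →+ Recovered K A :=
  TensorProduct.liftAddHom
    (AddMonoidHom.mk' (fun v => AddMonoidHom.mk'
        (fun u => a V.prolong (Prolong.der V.carrier v ⊗ₜ Prolong.dualF u))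
        (fun u t => by rw [Prolong.dualF_add, TensorProduct.tmul_add, map_add]))
      (fun v w => by
        ext u
        simp only [map_add, TensorProduct.add_tmul, AddMonoidHom.mk'_apply,
          AddMonoidHom.add_apply]))
    (fun c v u => by
      have h₁ : a V.prolong (Prolong.incl K V.carrier v ⊗ₜ Prolong.dualF u) = a V (v ⊗ₜ u) := by
        refine (a_hom (DiffRep.inclHom V) v (Prolong.dualF u)).symm.trans ?_
        congr 2
        exact LinearMap.ext fun x => Prolong.dualF_incl u x
      have h₂ : a V.prolong (Prolong.der V.carrier v ⊗ₜ (u ∘ₗ Prolong.proj K V.carrier))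
          = a V (v ⊗ₜ u) := a_hom (DiffRep.projHom V) (Prolong.der V.carrier v) u
      simp only [AddMonoidHom.mk'_apply]
      rw [Prolong.der_smul K, Prolong.dualF_smul, TensorProduct.add_tmul, TensorProduct.tmul_add,
        map_add, map_add, ← TensorProduct.smul_tmul', ← TensorProduct.smul_tmul',
        TensorProduct.tmul_smul, TensorProduct.tmul_smul, map_smul, map_smul, map_smul,
        h₁, h₂])

lemma derAux_tmul (V : DiffRep K A) (v : V.carrier) (u : Module.Dual K V.carrier) :
    derAux V (v ⊗ₜ u) = a V.prolong (Prolong.der V.carrier v ⊗ₜ Prolong.dualF u) := rfl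

/-- The additive map `∂ : 𝒜 → 𝒜` with `∂(a_V(v ⊗ u)) = a_{V⁽¹⁾}(∂v ⊗ F(u))`. -/
def der : Recovered K A →+ Recovered K A :=
  liftAdd derAux (fun V W φ v u => by
    rw [derAux_tmul, derAux_tmul, ← Prolong.map_der]
    refine Eq.trans ?_ (a_hom φ.prolong (Prolong.der V.carrier v) (Prolong.dualF u))
    congr 2
    refine Prolong.hom_ext (fun x => ?_) (fun x => ?_)
    · simp [DiffRep.Hom.prolong]
    · simp [DiffRep.Hom.prolong])

lemma der_a (V : DiffRep K A) (v : V.carrier) (u : Module.Dual K V.carrier) :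
    der (a V (v ⊗ₜ u)) = a V.prolong (Prolong.der V.carrier v ⊗ₜ Prolong.dualF u) :=
  liftAdd_a _ _ _ _

lemma a_prolong_incl (V : DiffRep K A) (v : V.carrier) (u : Module.Dual K V.carrier) :
    a V.prolong (Prolong.incl K V.carrier v ⊗ₜ Prolong.dualF u) = a V (v ⊗ₜ u) := by
  refine (a_hom (DiffRep.inclHom V) v (Prolong.dualF u)).symm.trans ?_
  congr 2
  exact LinearMap.ext fun x => Prolong.dualF_incl u x

lemma der_smul (c : K) (x : Recovered K A) : der (c • x) = c • der x + c′ • x := by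
  induction x using induction_on with
  | h0 => simp
  | hadd x y hx hy => rw [smul_add, map_add, hx, hy, map_add, smul_add, smul_add]; abel
  | ha V v u =>
    rw [← map_smul, TensorProduct.smul_tmul', der_a, der_a, Prolong.der_smul K,
      TensorProduct.add_tmul, map_add, ← TensorProduct.smul_tmul', ← TensorProduct.smul_tmul',
      map_smul, map_smul, a_prolong_incl]

lemma der_mul (x y : Recovered K A) : der (x * y) = x * der y + y * der x := by
  induction x using induction_on with
  | h0 => simp
  | hadd x x' hx hx' => rw [add_mul, map_add, hx, hx', map_add]; ring
  | ha V v u =>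
    induction y using induction_on with
    | h0 => simp
    | hadd x x' hx hx' => rw [mul_add, map_add, hx, hx', map_add]; ring
    | ha W w t =>
      have h : Prolong.dualF (TensorProduct.dualDistrib K V.carrier W.carrier (u ⊗ₜ t))
          = TensorProduct.dualDistrib K _ _ (Prolong.dualF u ⊗ₜ Prolong.dualF t) ∘ₗ
            leibnizMap K V.carrier W.carrier := by
        refine Prolong.hom_ext (fun x => ?_) (fun x => ?_)
        · induction x with
          | zero => simp
          | add x y hx hy => rw [map_add, map_add, map_add, hx, hy]
          | tmul x y => simp
        · induction x with
          | zero => simp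
          | add x y hx hy => rw [map_add, map_add, map_add, hx, hy]
          | tmul x y => simp; ring
      rw [a_mul_a, der_a, der_a, der_a, ← a_prolong_incl V, ← a_prolong_incl W, a_mul_a,
        mul_comm, a_mul_a, h]
      refine (a_hom (DiffRep.leibnizHom V W) (Prolong.der _ (v ⊗ₜ w))
        (TensorProduct.dualDistrib K _ _ (Prolong.dualF u ⊗ₜ Prolong.dualF t))).trans ?_
      rw [← map_add, ← TensorProduct.add_tmul, add_comm]
      exact congrArg (fun y => a (V.prolong.tensor W.prolong) (y ⊗ₜ _)) (leibnizMap_der v w)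

instance : Differential (Recovered K A) where
  deriv := Derivation.mk' der.toIntLinearMap der_mul

/-- `∂(a_V(v ⊗ u)) = a_{V⁽¹⁾}(∂v ⊗ F(u))`. -/
lemma deriv_a (V : DiffRep K A) (v : V.carrier) (u : Module.Dual K V.carrier) :
    (a V (v ⊗ₜ u))′ = a V.prolong (Prolong.der V.carrier v ⊗ₜ Prolong.dualF u) :=
  der_a V v u

instance : DifferentialAlgebra K (Recovered K A) where
  deriv_algebraMap c := by
    have h : (c • (1 : Recovered K A))′ = c • (1 : Recovered K A)′ + c′ • (1 : Recovered K A) :=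
      der_smul c 1
    rw [Algebra.algebraMap_eq_smul_one, Algebra.algebraMap_eq_smul_one, h]
    simp

end Recovered

end Recovered

end DiffTannaka

end

/-! The reason is that `A`, coacting on itself by `Δ`, contains a copy of every matrix coefficient,
and the counit is a universal functional there. For a representation `V` and `u ∈ V*`, the map `c_u
: V → A`, `v ↦ ψ_V(v ⊗ u)`, is a morphism from `V` to `(A, Δ)`. Its image `U` is a
finite-dimensional subcomodule, and `ε ∘ c_u = u`. So `u` is the pullback of `ε|_U`, and the
defining relation of `𝒜` for `V → U` gives `a_V(v ⊗ u) = a_U(c_u(v) ⊗ ε|_U)`.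

Two such classes can be moved into the common subcomodule `U + U'`, because `ε|_{U + U'}` restricts
to `ε|_U` and `ε|_{U'}`, and they can be added there. Hence every element of `𝒜`, not only a
generator, has the form `a_U(x ⊗ ε|_U)` (`Recovered.exists_eq_a_counitOn`).

By the counit axiom `Φ` sends this element to `(ε ⊗ id)Δ(x) = x` (`IsSubcomodule.psi_counitOn`). If
the image is zero then `x = 0` and the class is zero, so `Φ` is injective. Surjectivity is local
finiteness: each `x ∈ A` lies in some finite-dimensional subcomodule
(`exists_finiteDimensional_isSubcomodule`). Compatibility with products and derivations is a
computation with matrix coefficients of `V ⊗ W` and `V⁽¹⁾`. Finite `∂`-generation of `𝒜` is then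
inherited from `A` through `Φ⁻¹`. -/

noncomputable section

namespace DiffTannaka

open Coalgebra

/-! ### Subcomodules of the regular comodule `(A, Δ)` -/

section Subcomodule

variable {K A : Type u} [Field K] [CommRing A] [HopfAlgebra K A]

/-- A subspace `U` of `A` is a subcomodule if `Δ(U) ⊆ U ⊗ A`. -/
def IsSubcomodule (U : Submodule K A) : Prop :=
  ∀ x ∈ U, comul (R := K) x ∈ LinearMap.range (U.subtype.rTensor A)

/-- Every space over a field is flat, so `U ⊗ M` embeds in `A ⊗ M`. Identities for the coaction on
`U` are verified after this embedding, where the coaction becomes `Δ`. -/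
lemma rTensor_subtype_injective (U : Submodule K A) (M : Type*) [AddCommGroup M] [Module K M] :
    Function.Injective (U.subtype.rTensor M) :=
  Module.Flat.rTensor_preserves_injective_linearMap _ U.injective_subtype

lemma range_rTensor_subtype_mono {U U' : Submodule K A} (h : U ≤ U') :
    LinearMap.range (U.subtype.rTensor A) ≤ LinearMap.range (U'.subtype.rTensor A) := by
  rw [← Submodule.subtype_comp_inclusion U U' h, LinearMap.rTensor_comp]
  exact LinearMap.range_comp_le_range _ _

lemma IsSubcomodule.sup {U U' : Submodule K A} (h : IsSubcomodule U) (h' : IsSubcomodule U') :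
    IsSubcomodule (U ⊔ U') := by
  intro x hx
  obtain ⟨y, hy, z, hz, rfl⟩ := Submodule.mem_sup.1 hx
  rw [map_add]
  exact add_mem (range_rTensor_subtype_mono le_sup_left (h y hy))
    (range_rTensor_subtype_mono le_sup_right (h' z hz))

/-- The coaction of a subcomodule, the restriction of the comultiplication. -/
def IsSubcomodule.coaction {U : Submodule K A} (h : IsSubcomodule U) : U →ₗ[K] U ⊗[K] A :=
  (LinearEquiv.ofInjective _ (rTensor_subtype_injective U A)).symm.toLinearMap ∘ₗ
    (comul (R := K) ∘ₗ U.subtype).codRestrict _ (fun x => h x x.2)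

lemma IsSubcomodule.subtype_coaction {U : Submodule K A} (h : IsSubcomodule U) (x : U) :
    U.subtype.rTensor A (h.coaction x) = comul (R := K) (x : A) :=
  congrArg Subtype.val ((LinearEquiv.ofInjective _ (rTensor_subtype_injective U A)).apply_symm_apply
    ((comul (R := K) ∘ₗ U.subtype).codRestrict _ (fun x => h x x.2) x))

lemma rTensor_lTensor_comm {M N P Q : Type*} [AddCommGroup M] [Module K M] [AddCommGroup N]
    [Module K N] [AddCommGroup P] [Module K P] [AddCommGroup Q] [Module K Q]
    (f : M →ₗ[K] N) (g : P →ₗ[K] Q) (x : M ⊗[K] P) :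
    f.rTensor Q (g.lTensor M x) = g.lTensor N (f.rTensor P x) :=
  LinearMap.congr_fun ((LinearMap.rTensor_comp_lTensor ..).trans
    (LinearMap.lTensor_comp_rTensor ..).symm) x

lemma rTensor_assoc {M N P Q : Type*} [AddCommGroup M] [Module K M] [AddCommGroup N]
    [Module K N] [AddCommGroup P] [Module K P] [AddCommGroup Q] [Module K Q]
    (f : M →ₗ[K] N) (x : (M ⊗[K] P) ⊗[K] Q) :
    f.rTensor (P ⊗[K] Q) (TensorProduct.assoc K M P Q x)
      = TensorProduct.assoc K N P Q ((f.rTensor P).rTensor Q x) :=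
  LinearMap.congr_fun (f := f.rTensor (P ⊗[K] Q) ∘ₗ (TensorProduct.assoc K M P Q).toLinearMap)
    (g := (TensorProduct.assoc K N P Q).toLinearMap ∘ₗ (f.rTensor P).rTensor Q)
    (TensorProduct.ext_threefold fun _ _ _ => rfl) x

/-- A finite-dimensional subcomodule of `A` as a representation. -/
@[reducible] def IsSubcomodule.rep {U : Submodule K A} [FiniteDimensional K U]
    (h : IsSubcomodule U) : DiffRep K A where
  carrier := U
  ρ := h.coaction
  coassoc x := by
    -- Inside `A ⊗ (A ⊗ A)` both sides become iterated comultiplications of `x`, and the claim is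
    -- the coassociativity of `Δ`.
    apply rTensor_subtype_injective U (A ⊗[K] A)
    have hc : U.subtype.rTensor A ∘ₗ h.coaction = comul (R := K) ∘ₗ U.subtype :=
      LinearMap.ext h.subtype_coaction
    rw [rTensor_assoc, rTensor_lTensor_comm, h.subtype_coaction, ← LinearMap.rTensor_comp_apply,
      hc, LinearMap.rTensor_comp_apply, h.subtype_coaction, coassoc_apply]
  counit x := by
    apply rTensor_subtype_injective U K
    rw [rTensor_lTensor_comm, h.subtype_coaction, lTensor_counit_comul]
    rfl

/-- The restriction of the counit to a subspace of `A`. -/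
def counitOn (U : Submodule K A) : Module.Dual K U := counit (R := K) ∘ₗ U.subtype

/-- This is the counit axiom `(ε ⊗ id)Δ = id`. Both the injectivity and the surjectivity of `Φ` rest
on it. -/
lemma IsSubcomodule.psi_counitOn {U : Submodule K A} [FiniteDimensional K U]
    (h : IsSubcomodule U) (x : U) : h.rep.psi (x ⊗ₜ counitOn U) = x := by
  rw [DiffRep.psi_tmul, counitOn, LinearMap.rTensor_comp_apply, h.subtype_coaction,
    rTensor_counit_comul]
  simp

/-- The inclusion of a subcomodule in a larger one. -/
def IsSubcomodule.inclusionHom {U U' : Submodule K A} [FiniteDimensional K U]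
    [FiniteDimensional K U'] (h : IsSubcomodule U) (h' : IsSubcomodule U') (hU : U ≤ U') :
    h.rep.Hom h'.rep where
  lin := Submodule.inclusion hU
  comm x := by
    apply rTensor_subtype_injective U' A
    rw [h'.subtype_coaction, ← LinearMap.rTensor_comp_apply, Submodule.subtype_comp_inclusion,
      h.subtype_coaction]
    rfl

/-- The relation for the inclusion `U → U'` applies because `ε|_{U'}` restricts to `ε|_U`. It allows
a class to be moved into any larger finite-dimensional subcomodule. -/
lemma Recovered.a_counitOn_of_le {U U' : Submodule K A} [FiniteDimensional K U]
    [FiniteDimensional K U'] (h : IsSubcomodule U) (h' : IsSubcomodule U') (hU : U ≤ U') (x : U) :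
    a h.rep (x ⊗ₜ counitOn U) = a h'.rep (Submodule.inclusion hU x ⊗ₜ counitOn U') :=
  a_hom (h.inclusionHom h' hU) x (counitOn U')

/-! ### Local finiteness of the regular comodule -/

/-- The contraction `(id ⊗ f) ∘ Δ` of the comultiplication. -/
def rightContract (f : Module.Dual K A) : A →ₗ[K] A :=
  (TensorProduct.rid K A).toLinearMap ∘ₗ f.lTensor A ∘ₗ comul (R := K)

lemma rightContract_counit (x : A) : rightContract (counit (R := K)) x = x := by
  simp [rightContract]

/-- By coassociativity both sides are `∑ x₁ g(x₂) f(x₃)`: contractions compose through the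
convolution product of functionals. So the set of all contractions of `Δ(x)` is stable under further
contraction. -/
lemma rightContract_rightContract (f g : Module.Dual K A) (x : A) :
    rightContract g (rightContract f x)
      = rightContract (LinearMap.mul' K K ∘ₗ TensorProduct.map g f ∘ₗ comul (R := K)) x := by
  have h₁ : ∀ y : A ⊗[K] A, rightContract g (TensorProduct.rid K A (f.lTensor A y))
      = TensorProduct.rid K A ((LinearMap.mul' K K ∘ₗ TensorProduct.map g f).lTensor A
          (TensorProduct.assoc K A A A ((comul (R := K)).rTensor A y))) := by
    intro y
    induction y with
    | zero => simp
    | add y z hy hz => simp only [map_add, hy, hz]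
    | tmul b c =>
      simp only [rightContract, LinearMap.comp_apply, LinearEquiv.coe_coe, LinearMap.lTensor_tmul,
        TensorProduct.rid_tmul, map_smul, LinearMap.rTensor_tmul]
      induction comul (R := K) b with
      | zero => simp
      | add y z hy hz => simp only [map_add, TensorProduct.add_tmul, smul_add, hy, hz]
      | tmul d e => simp [smul_smul, mul_comm]
  refine (h₁ _).trans ?_
  -- For `y = Δ(x)` the right-hand side of `h₁` contains `(Δ ⊗ id)Δ(x)`, which coassociativity
  -- replaces by `(id ⊗ Δ)Δ(x)`.
  rw [coassoc_apply, ← LinearMap.lTensor_comp_apply]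
  rfl

/-- A tensor all of whose contractions lie in `U` belongs to `U ⊗ N`. -/
lemma mem_range_rTensor_subtype {M N : Type*} [AddCommGroup M] [Module K M] [AddCommGroup N]
    [Module K N] (U : Submodule K M) (x : M ⊗[K] N)
    (hx : ∀ f : Module.Dual K N, TensorProduct.rid K M (f.lTensor M x) ∈ U) :
    x ∈ LinearMap.range (U.subtype.rTensor N) := by
  let b := Module.Basis.ofVectorSpace K N
  -- Expansion of `y` along the basis `b` of `N`, whose coefficients are contractions of `y`.
  -- Allowing every finite `t ⊇ s` lets the expansions of two summands be taken over the same index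
  -- set.
  have h : ∀ y : M ⊗[K] N, ∃ s : Finset _, ∀ t, s ⊆ t →
      y = ∑ i ∈ t, TensorProduct.rid K M ((b.coord i).lTensor M y) ⊗ₜ[K] b i := by
    classical
    intro y
    induction y with
    | zero => exact ⟨∅, fun t _ => by simp⟩
    | add y z hy hz =>
      obtain ⟨s, hs⟩ := hy
      obtain ⟨s', hs'⟩ := hz
      refine ⟨s ∪ s', fun t ht => ?_⟩
      simp only [map_add, TensorProduct.add_tmul, Finset.sum_add_distrib]
      rw [← hs t (Finset.union_subset_left ht), ← hs' t (Finset.union_subset_right ht)]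
    | tmul m n =>
      refine ⟨(b.repr n).support, fun t ht => ?_⟩
      simp only [LinearMap.lTensor_tmul, TensorProduct.rid_tmul, TensorProduct.smul_tmul,
        ← TensorProduct.tmul_sum, Module.Basis.coord_apply]
      congr 1
      conv_lhs => rw [← b.linearCombination_repr n, Finsupp.linearCombination_apply]
      exact Finsupp.sum_of_support_subset _ ht _ (by simp)
  obtain ⟨s, hs⟩ := h x
  rw [hs s subset_rfl]
  exact sum_mem fun i _ => ⟨(⟨_, hx (b.coord i)⟩ : U) ⊗ₜ b i, rfl⟩

/-- The map `f ↦ (id ⊗ f)(x)`. -/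
def contractLin {M N : Type*} [AddCommGroup M] [Module K M] [AddCommGroup N] [Module K N]
    (x : M ⊗[K] N) : Module.Dual K N →ₗ[K] M where
  toFun f := TensorProduct.rid K M (f.lTensor M x)
  map_add' f g := by simp [LinearMap.lTensor_add]
  map_smul' c f := by simp [LinearMap.lTensor_smul]

/-- The contractions of a pure tensor `m ⊗ n` lie on the line `K m`, and `x` is a finite sum of pure
tensors. -/
lemma finiteDimensional_range_contractLin {M N : Type*} [AddCommGroup M] [Module K M]
    [AddCommGroup N] [Module K N] (x : M ⊗[K] N) :
    FiniteDimensional K (LinearMap.range (contractLin x)) := by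
  -- The induction on `x` is run with a bounding space `W`, since the range for a sum is only
  -- contained in the sum of the ranges.
  suffices h : ∃ W : Submodule K M, FiniteDimensional K W ∧ ∀ f, contractLin x f ∈ W by
    obtain ⟨W, hW, h⟩ := h
    exact Submodule.finiteDimensional_of_le (S₂ := W) (by rintro _ ⟨f, rfl⟩; exact h f)
  induction x with
  | zero => exact ⟨⊥, inferInstance, fun f => by simp [contractLin]⟩
  | add x y hx hy =>
    obtain ⟨W, hW, h⟩ := hx
    obtain ⟨W', hW', h'⟩ := hy
    refine ⟨W ⊔ W', inferInstance, fun f => ?_⟩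
    have : contractLin (x + y) f = contractLin x f + contractLin y f := by simp [contractLin]
    rw [this]
    exact Submodule.add_mem_sup (h f) (h' f)
  | tmul m n =>
    exact ⟨K ∙ m, inferInstance, fun f => by
      simpa [contractLin] using Submodule.smul_mem _ _ (Submodule.mem_span_singleton_self m)⟩

/-- Every element of `A` lies in a finite-dimensional subcomodule. -/
lemma exists_finiteDimensional_isSubcomodule (x : A) :
    ∃ U : Submodule K A, FiniteDimensional K U ∧ IsSubcomodule U ∧ x ∈ U := by
  -- The subcomodule is the space of all `(id ⊗ f)Δ(x)`. The choice `f = ε` shows that it contains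
  -- `x`.
  refine ⟨LinearMap.range (contractLin (comul (R := K) x)),
    finiteDimensional_range_contractLin _, ?_, counit, rightContract_counit x⟩
  rintro _ ⟨f, rfl⟩
  -- To place `Δ` of a contraction in `U ⊗ A` it suffices to contract it with every `g`. The result
  -- is again a contraction of `Δ(x)`, by the convolution of `g` and `f`.
  exact mem_range_rTensor_subtype _ _ fun g =>
    ⟨_, (rightContract_rightContract f g x).symm⟩

end Subcomodule

/-! ### Matrix coefficients as morphisms to the regular comodule -/

section Coefficients

variable {K A : Type u} [Field K] [CommRing A] [HopfAlgebra K A]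

/-- The map `V → A`, `v ↦ ψ_V(v ⊗ u)`. -/
def DiffRep.coeffMap (V : DiffRep K A) (u : Module.Dual K V.carrier) : V.carrier →ₗ[K] A :=
  (TensorProduct.lid K A).toLinearMap ∘ₗ u.rTensor A ∘ₗ V.ρ

/-- Applying `u` to the first factor of the coassociativity of `ρ` gives this identity. It says that
`v ↦ ψ_V(v ⊗ u)` is a comodule map from `V` to `(A, Δ)`. -/
lemma DiffRep.comul_coeffMap (V : DiffRep K A) (u : Module.Dual K V.carrier) (v : V.carrier) :
    comul (R := K) (V.coeffMap u v) = (V.coeffMap u).rTensor A (V.ρ v) := by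
  have h₁ : ∀ y : V.carrier ⊗[K] A,
      comul (R := K) (TensorProduct.lid K A (u.rTensor A y))
        = TensorProduct.lid K (A ⊗[K] A) (u.rTensor (A ⊗[K] A)
            ((comul (R := K)).lTensor V.carrier y)) := by
    intro y
    induction y with
    | zero => simp
    | add y z hy hz => simp only [map_add, hy, hz]
    | tmul w b => simp
  have h₂ : ∀ y : (V.carrier ⊗[K] A) ⊗[K] A,
      TensorProduct.lid K (A ⊗[K] A) (u.rTensor (A ⊗[K] A)
          (TensorProduct.assoc K V.carrier A A y))
        = ((TensorProduct.lid K A).toLinearMap ∘ₗ u.rTensor A).rTensor A y :=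
    LinearMap.congr_fun
      (f := (TensorProduct.lid K (A ⊗[K] A)).toLinearMap ∘ₗ u.rTensor (A ⊗[K] A) ∘ₗ
        (TensorProduct.assoc K V.carrier A A).toLinearMap)
      (TensorProduct.ext_threefold fun w b c => by simp [TensorProduct.smul_tmul'])
  refine (h₁ (V.ρ v)).trans ?_
  rw [← V.coassoc, h₂, ← LinearMap.rTensor_comp_apply]
  rfl

/-- Applying `u` to the counit axiom of `V` gives this identity. It exhibits `u` as the pullback of
`ε`, so that no information is lost in passing from `V` to the image of the coefficient map. -/
lemma DiffRep.counit_coeffMap (V : DiffRep K A) (u : Module.Dual K V.carrier) (v : V.carrier) :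
    Coalgebra.counit (R := K) (V.coeffMap u v) = u v := by
  have h₁ : ∀ y : V.carrier ⊗[K] A,
      Coalgebra.counit (R := K) (TensorProduct.lid K A (u.rTensor A y))
        = TensorProduct.lid K K (u.rTensor K ((Coalgebra.counit (R := K)).lTensor V.carrier y)) := by
    intro y
    induction y with
    | zero => simp
    | add y z hy hz => simp only [map_add, hy, hz]
    | tmul w b => simp
  refine (h₁ (V.ρ v)).trans ?_
  rw [V.counit]
  simp

lemma DiffRep.isSubcomodule_range_coeffMap (V : DiffRep K A) (u : Module.Dual K V.carrier) :
    IsSubcomodule (LinearMap.range (V.coeffMap u)) := by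
  rintro _ ⟨v, rfl⟩
  refine ⟨(V.coeffMap u).rangeRestrict.rTensor A (V.ρ v), ?_⟩
  rw [V.comul_coeffMap, ← LinearMap.rTensor_comp_apply]
  rfl

/-- The map `v ↦ ψ_V(v ⊗ u)` as a morphism onto its image. -/
def DiffRep.coeffHom (V : DiffRep K A) (u : Module.Dual K V.carrier) :
    V.Hom (V.isSubcomodule_range_coeffMap u).rep where
  lin := (V.coeffMap u).rangeRestrict
  comm v := by
    apply rTensor_subtype_injective _ A
    rw [IsSubcomodule.subtype_coaction, ← LinearMap.rTensor_comp_apply]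
    exact V.comul_coeffMap u v

/-- Matrix coefficients respect the defining relations of `𝒜`, so they descend to the quotient. -/
lemma DiffRep.psi_hom {V W : DiffRep K A} (φ : V.Hom W) (v : V.carrier)
    (u : Module.Dual K W.carrier) : V.psi (v ⊗ₜ (u ∘ₗ φ.lin)) = W.psi (φ.lin v ⊗ₜ u) := by
  rw [psi_tmul, psi_tmul, φ.comm, LinearMap.rTensor_comp_apply]

lemma DiffRep.psi_tensor (V W : DiffRep K A) (v : V.carrier) (u : Module.Dual K V.carrier)
    (w : W.carrier) (t : Module.Dual K W.carrier) :
    (V.tensor W).psi ((v ⊗ₜ w) ⊗ₜ TensorProduct.dualDistrib K _ _ (u ⊗ₜ t))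
      = V.psi (v ⊗ₜ u) * W.psi (w ⊗ₜ t) := by
  rw [psi_tmul, psi_tmul, psi_tmul, tensorCoaction_tmul]
  induction V.ρ v with
  | zero => simp
  | add x y hx hy => simp only [TensorProduct.add_tmul, map_add, add_mul, hx, hy]
  | tmul x a =>
    induction W.ρ w with
    | zero => simp
    | add x y hx hy => simp only [TensorProduct.tmul_add, map_add, mul_add, hx, hy]
    | tmul y b => simp [smul_smul, mul_comm]

/-- On a term `x ⊗ a` of `ρ(v)`, applying `F(u) ⊗ id` to `∂x ⊗ a + x ⊗ a′` gives `u(x)′ a + u(x) a′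
= (u(x) a)′`. The functional `F(u)` is designed for this product rule. -/
lemma DiffRep.psi_prolong [Differential K] [Differential A] [DifferentialAlgebra K A]
    [DiffHopfAlgebra K A] (V : DiffRep K A) (v : V.carrier) (u : Module.Dual K V.carrier) :
    V.prolong.psi (Prolong.der V.carrier v ⊗ₜ Prolong.dualF u) = (V.psi (v ⊗ₜ u))′ := by
  rw [psi_tmul, psi_tmul, prolongCoaction_der]
  induction V.ρ v with
  | zero => simp
  | add x y hx hy => simp only [map_add, hx, hy]
  | tmul x a =>
    simp [Algebra.smul_def, deriv_algebraMap]
    ring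

end Coefficients

/-! ### Normal form in `𝒜` and the isomorphism `Φ` -/

namespace Recovered

variable {K A : Type u} [Field K] [CommRing A] [HopfAlgebra K A]

/-- Every element of `𝒜` is `a_U(x ⊗ ε)` for a finite-dimensional subcomodule `U` of `A`. -/
lemma exists_eq_a_counitOn (z : Recovered K A) :
    ∃ (U : Submodule K A) (_ : FiniteDimensional K U) (h : IsSubcomodule U) (x : U),
      z = a h.rep (x ⊗ₜ counitOn U) := by
  induction z using induction_on with
  | h0 =>
    obtain ⟨U, hU, h, -⟩ := exists_finiteDimensional_isSubcomodule (K := K) (0 : A)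
    exact ⟨U, hU, h, 0, by simp⟩
  | ha V v u =>
    -- `U` is the image of `v ↦ ψ_V(v ⊗ u)`. The relation for `V → U` moves the class to `U`,
    -- because `u` is the pullback of `ε|_U`.
    refine ⟨_, inferInstance, V.isSubcomodule_range_coeffMap u, (V.coeffMap u).rangeRestrict v, ?_⟩
    refine Eq.trans ?_ (a_hom (V.coeffHom u) v (counitOn _))
    congr 2
    exact LinearMap.ext fun w => (V.counit_coeffMap u w).symm
  | hadd z z' hz hz' =>
    obtain ⟨U, hU, h, x, rfl⟩ := hz
    obtain ⟨U', hU', h', x', rfl⟩ := hz'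
    -- Both classes are moved to `U + U'`. There they share the functional `ε`, and the sum is taken
    -- in the first tensor factor.
    refine ⟨U ⊔ U', inferInstance, h.sup h',
      Submodule.inclusion le_sup_left x + Submodule.inclusion le_sup_right x', ?_⟩
    rw [a_counitOn_of_le h (h.sup h') le_sup_left, a_counitOn_of_le h' (h.sup h') le_sup_right,
      TensorProduct.add_tmul, map_add]

/-- The linear map `𝒜 → A` given by the matrix coefficients. -/
def toHopfLin : Recovered K A →ₗ[K] A :=
  lift DiffRep.psi fun _ _ φ v u => DiffRep.psi_hom φ v u

@[simp] lemma toHopfLin_a (V : DiffRep K A) (z : V.carrier ⊗[K] Module.Dual K V.carrier) :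
    toHopfLin (a V z) = V.psi z := lift_a _ _ V z

/-- The algebra homomorphism `Φ : 𝒜 → A` given by the matrix coefficients. -/
def toHopf : Recovered K A →ₐ[K] A :=
  AlgHom.ofLinearMap toHopfLin (by rw [one_def, toHopfLin_a, DiffRep.psi_tmul]; simp) (fun x y => by
    induction x using induction_on with
    | h0 => simp
    | hadd x x' hx hx' => rw [add_mul, map_add, hx, hx', map_add, add_mul]
    | ha V v u =>
      induction y using induction_on with
      | h0 => simp
      | hadd x x' hx hx' => rw [mul_add, map_add, hx, hx', map_add, mul_add]
      | ha W w t => rw [a_mul_a, toHopfLin_a, toHopfLin_a, toHopfLin_a, DiffRep.psi_tensor])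

@[simp] lemma toHopf_a (V : DiffRep K A) (z : V.carrier ⊗[K] Module.Dual K V.carrier) :
    toHopf (a V z) = V.psi z := toHopfLin_a V z

lemma toHopf_surjective : Function.Surjective (toHopf (K := K) (A := A)) := by
  intro x
  obtain ⟨U, hU, h, hx⟩ := exists_finiteDimensional_isSubcomodule (K := K) x
  exact ⟨a h.rep ((⟨x, hx⟩ : U) ⊗ₜ counitOn U), by rw [toHopf_a, h.psi_counitOn]⟩

/-- In the normal form `a_U(x ⊗ ε|_U)` the image under `Φ` is `x` itself, so a zero image forces the
class to vanish. -/
lemma toHopf_injective : Function.Injective (toHopf (K := K) (A := A)) := by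
  refine (injective_iff_map_eq_zero _).2 fun z hz => ?_
  obtain ⟨U, hU, h, x, rfl⟩ := exists_eq_a_counitOn z
  rw [toHopf_a, h.psi_counitOn] at hz
  rw [Subtype.ext (a1 := x) (a2 := 0) hz, TensorProduct.zero_tmul, map_zero]

lemma toHopf_deriv [Differential K] [Differential A] [DifferentialAlgebra K A]
    [DiffHopfAlgebra K A] (x : Recovered K A) : toHopf x′ = (toHopf x)′ := by
  induction x using induction_on with
  | h0 => simp
  | hadd x y hx hy => simp only [map_add, hx, hy]
  | ha V v u => rw [deriv_a, toHopf_a, toHopf_a, DiffRep.psi_prolong]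

end Recovered

/-! ### Finite `∂`-generation and the theorem -/

/-- Finite `∂`-generation is transported by isomorphisms of differential algebras. -/
lemma FinitelyDiffGenerated.of_algEquiv {K R S : Type*} [Field K] [CommRing R] [Algebra K R]
    [Differential R] [CommRing S] [Algebra K S] [Differential S] (e : R ≃ₐ[K] S)
    (he : ∀ x, e x′ = (e x)′) (h : FinitelyDiffGenerated K R) : FinitelyDiffGenerated K S := by
  classical
  obtain ⟨X, hX⟩ := h
  have hi : ∀ (i : ℕ) (x : R), e ((fun z : R => z′)^[i] x) = (fun z : S => z′)^[i] (e x) :=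
    fun i x => Function.Semiconj.iterate_right (f := e) he i x
  refine ⟨X.image e, top_le_iff.1 ?_⟩
  -- `S` is the image under `e` of the algebra generated by the `∂ⁱ x`, hence is generated by the
  -- elements `e(∂ⁱ x) = ∂ⁱ(e x)`.
  rw [← (AlgHom.range_eq_top e.toAlgHom).2 e.surjective, ← Algebra.map_top, ← hX,
    AlgHom.map_adjoin]
  refine Algebra.adjoin_mono ?_
  rintro _ ⟨_, ⟨x, hx, i, rfl⟩, rfl⟩
  exact ⟨e x, Finset.mem_image_of_mem e hx, i, hi i x⟩

end DiffTannaka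

end

/-- `A = K{G}` is the differential Hopf algebra of a linear differential algebraic group `G` over
the differential field `K` of characteristic `0`, and `Recovered K A` is the differential algebra
`𝒜` built from the category of its differential representations. -/
theorem mainTheorem2 {K A : Type u} [Field K] [CharZero K] [Differential K]
    [CommRing A] [HopfAlgebra K A] [Differential A] [DifferentialAlgebra K A]
    [DiffTannaka.DiffHopfAlgebra K A] (hA : DiffTannaka.FinitelyDiffGenerated K A) :
    DiffTannaka.FinitelyDiffGenerated K (DiffTannaka.Recovered K A) ∧
      ∃ Φ : DiffTannaka.Recovered K A →ₐ[K] A,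
        (∀ x : DiffTannaka.Recovered K A, (Φ (x′) = (Φ x)′)) ∧
        (∀ (V : DiffTannaka.DiffRep K A) (z : V.carrier ⊗[K] Module.Dual K V.carrier),
          Φ (DiffTannaka.Recovered.a V z) = V.psi z) ∧
        Function.Surjective Φ ∧
        Function.Bijective Φ := by
  have hbij : Function.Bijective (DiffTannaka.Recovered.toHopf (K := K) (A := A)) :=
    ⟨DiffTannaka.Recovered.toHopf_injective, DiffTannaka.Recovered.toHopf_surjective⟩
  refine ⟨?_, DiffTannaka.Recovered.toHopf, DiffTannaka.Recovered.toHopf_deriv,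
    DiffTannaka.Recovered.toHopf_a, hbij.2, hbij⟩
  let e := AlgEquiv.ofBijective _ hbij
  -- Generators of `A` are carried to `𝒜` by `Φ⁻¹`. That `Φ⁻¹` commutes with `∂` is checked after
  -- applying the injective map `Φ`.
  refine hA.of_algEquiv e.symm fun x => e.injective ?_
  rw [e.apply_symm_apply]
  refine Eq.symm ((DiffTannaka.Recovered.toHopf_deriv (e.symm x)).trans ?_)
  exact congrArg (fun y : A => y′) (e.apply_symm_apply x)
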